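/- Let $\mathcal H$ be a complex Hilbert space, $\Omega\subseteq\mathbb C$ open and connected, and let $A:\Omega\to\mathcal B(\mathcal H)$ be analytic with $A(z)$ Fredholm for every $z\in\Omega$. Let $z_0\in\Omega$ be a pole of $A(\cdot)^{-1}$ of order $n_0\ge 1$ (so $A(z)$ is boundedly invertible for $z\ne z_0$ near $z_0$). Write $\operatorname{ind}(T)=\dim\ker T-\dim\ker T^*$ for Fredholm $T$, $\mathcal F(\mathcal H)$ for the bounded finite rank operators, $\mathcal B_p(\mathcal H)$, $1\le p<\infty$, for the Schatten--von Neumann classes, $\mathcal B_\infty(\mathcal H)$ for the compact operators, and $m_g(0;A(z_0))=\dim\ker A(z_0)$. Definition of $\nu(z_0;A)$. Suppose that $0$ is an isolated point of the spectrum of $A(z_0)$, and let $\varepsilon>0$ be such that every $\zeta$ with $0<|\zeta|\le\varepsilon$ lies in the resolvent set of $A(z_0)$. For $z$ near $z_0$ put $$P(z)=-\frac1{2\pi i}\oint_{|\zeta|=\varepsilon}(A(z)-\zeta I)^{-1}\,d\zeta,\qquad T(z)=P(z_0)P(z)+(I-P(z_0))(I-P(z)),$$ and let $F(z)$ be the block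 of $T(z)A(z)T(z)^{-1}$ acting in the finite-dimensional space $\operatorname{ran}P(z_0)$, relative to $\mathcal H=\operatorname{ran}P(z_0)\dotplus\operatorname{ran}(I-P(z_0))$. Then $\nu(z_0;A)$ is the order of the zero of $z\mapsto\det F(z)$ at $z_0$ (and $\infty$ if $\det F$ vanishes identically near $z_0$). Theorem. There exist bounded (not necessarily orthogonal) projections $P_1,\dots,P_{n_0}$ in $\mathcal H$, with $Q_j=I-P_j$ and $p_j=\dim\operatorname{ran}P_j$, and a function $A_{n_0}:\Omega\to\mathcal B(\mathcal H)$ such that $$A(z)=[Q_1-(z-z_0)P_1]\,[Q_2-(z-z_0)P_2]\cdots[Q_{n_0}-(z-z_0)P_{n_0}]\,A_{n_0}(z),\quad z\in\Omega,$$ $$1\le p_{n_0}\le p_{n_0-1}\le\dots\le p_1<\infty,$$ where $A_{n_0}$ is analytic on $\Omega$, $A_{n_0}(z)$ is Fredholm for every $z\in\Omega$, and, for all $z$ sufficiently close to $z_0$, $\operatorname{ind}(A(z))=\operatorname{ind}(A_{n_0}(z))=0$ and $A_{n_0}(z)$ is boundedly invertible. Moreover $p_1=\dim\ker A(z_0)=m_g(0;A(z_0))$,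 and hence $$\sum_{j=1}^{n_0}p_j\ge m_g(0;A(z_0)),\qquad \sum_{j=1}^{n_0}p_j\ge n_0 .$$ If $0$ is an isolated point of the spectrum of $A(z_0)$, so that $\nu(z_0;A)$ is defined, then for every $\varepsilon$ as above $$\nu(z_0;A)=\sum_{j=1}^{n_0}p_j\ge m_g(0;A(z_0)),\qquad \nu(z_0;A)\ge n_0 .$$ Finally, for every $z\in\Omega$, $I-A(z)\in\mathcal F(\mathcal H)$ if and only if $I-A_{n_0}(z)\in\mathcal F(\mathcal H)$, and for every $1\le p\le\infty$, $I-A(z)\in\mathcal B_p(\mathcal H)$ if and only if $I-A_{n_0}(z)\in\mathcal B_p(\mathcal H)$. -/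

import Mathlib

open scoped ENNReal Topology

noncomputable section

namespace Howland

variable {H : Type*} [NormedAddCommGroup H] [InnerProductSpace ℂ H] [CompleteSpace H]

/-- The operator-valued function `z ↦ A(z)⁻¹` has a pole of order `n` at `z₀` (for `n ≥ 1`):
`A(z)` is boundedly invertible for `z ≠ z₀` close to `z₀`, and the Laurent expansion of `A(z)⁻¹`
at `z₀` starts exactly with the power `(z - z₀) ^ (-n)`. -/
def InverseHasPole (A : ℂ → H →L[ℂ] H) (z₀ : ℂ) (n : ℕ) : Prop :=
  (∀ᶠ z in 𝓝[≠] z₀, IsUnit (A z)) ∧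
    MeromorphicAt (fun z => Ring.inverse (A z)) z₀ ∧
    meromorphicOrderAt (fun z => Ring.inverse (A z)) z₀ = ((-(n : ℤ) : ℤ) : WithTop ℤ)

/-- The Fredholm index `dim ker T - dim ker T*` (used for Fredholm operators `T`, for which
both dimensions are finite). -/
def index (T : H →L[ℂ] H) : ℤ :=
  (Module.finrank ℂ T.ker : ℤ) - (Module.finrank ℂ (ContinuousLinearMap.adjoint T).ker : ℤ)

/-- Bounded operators of finite rank. -/
def IsFiniteRank (T : H →L[ℂ] H) : Prop := FiniteDimensional ℂ T.range

/-- The `n`-th singular number `s_n(T)`, `n = 0, 1, 2, …`: the distance, in operator norm, of `T`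
to the operators of rank at most `n`. For compact `T` these are the eigenvalues of
`(T* T)^(1/2)` in decreasing order, repeated according to multiplicity. -/
def singularNumber (T : H →L[ℂ] H) (n : ℕ) : ℝ :=
  sInf {r : ℝ | ∃ F : H →L[ℂ] H, IsFiniteRank F ∧ Module.finrank ℂ F.range ≤ n ∧ r = ‖T - F‖}

/-- The Schatten - von Neumann class of exponent `p`: the compact operators for `p = ∞`, and
the operators with `∑ₙ s_n(T) ^ p < ∞` for `p < ∞`. -/
def IsSchatten (p : ℝ≥0∞) (T : H →L[ℂ] H) : Prop :=
  (p = ∞ ∧ IsCompactOperator T) ∨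
    (p ≠ ∞ ∧ Summable fun n : ℕ => singularNumber T n ^ p.toReal)

/-- The Riesz projection `-(2πi)⁻¹ ∮ (T - ζ)⁻¹ dζ`, over the positively oriented circle of
radius `ε` around `0`. -/
def rieszProj (T : H →L[ℂ] H) (ε : ℝ) : H →L[ℂ] H :=
  (-(2 * (Real.pi : ℂ) * Complex.I)⁻¹) •
    ∮ ζ in C(0, ε), Ring.inverse (T - ζ • (1 : H →L[ℂ] H))

/-- The transformation `T(z) = P(z₀) P(z) + (I - P(z₀)) (I - P(z))`, where `P(z)` is the Riesz
projection of `A(z)` for the circle of radius `ε` around `0`. -/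
def wolfTransform (A : ℂ → H →L[ℂ] H) (z₀ : ℂ) (ε : ℝ) (z : ℂ) : H →L[ℂ] H :=
  rieszProj (A z₀) ε * rieszProj (A z) ε +
    (1 - rieszProj (A z₀) ε) * (1 - rieszProj (A z) ε)

/-- The block `F(z)` of `T(z) A(z) T(z)⁻¹` in the space `ran P(z₀)`, with respect to the
decomposition of `H` as the direct sum of `ran P(z₀)` and `ran (I - P(z₀))`. -/
def rieszBlock (A : ℂ → H →L[ℂ] H) (z₀ : ℂ) (ε : ℝ) (z : ℂ) :
    (rieszProj (A z₀) ε).range →ₗ[ℂ] (rieszProj (A z₀) ε).range :=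
  (rieszProj (A z₀) ε).toLinearMap.rangeRestrict ∘ₗ
    (wolfTransform A z₀ ε z * A z * Ring.inverse (wolfTransform A z₀ ε z)).toLinearMap ∘ₗ
    (rieszProj (A z₀) ε).range.subtype

/-- Howland's quantity `ν(z₀; A)`: the order of the zero of `z ↦ det F(z)` at `z₀`, with the
value `∞` if `det F(z)` vanishes identically near `z₀`. -/
def nu (A : ℂ → H →L[ℂ] H) (z₀ : ℂ) (ε : ℝ) : WithTop ℤ :=
  meromorphicOrderAt (fun z => LinearMap.det (rieszBlock A z₀ ε z)) z₀

end Howland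

end

/-!
The operator `A₀ = A(z₀)` is Fredholm and a limit of invertible operators, so it has index zero, and
the orthogonal projection `P` onto `(ran A₀)ᗮ` has rank `dim ker A₀`. Since `P A(z₀) = 0`, the quotient
`A₁(z) = [Q - (z - z₀) P]⁻¹ A(z)`, with `Q = 1 - P`, has a removable singularity at `z₀`
(`elemFactor_mul_divFactor`). It differs from `A` by operators of finite rank, hence is Fredholm,
its kernel at `z₀` lies in `ker A(z₀)`, and the order of the pole of its inverse is one less,
because the leading Laurent coefficient of `A(z)⁻¹` annihilates `ran A(z₀)`
(`InverseHasPole.of_elemFactor_mul`). After `n₀` steps the remaining factor is invertible at `z₀`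
(`exists_factorization`). As `A - A_{n₀}` has finite rank values, and as finite rank perturbations
preserve all the operator ideals concerned, the statements on ideals follow.

For Howland's quantity, the Riesz projections `P(z)` are idempotent, commute with `A(z)` and depend
analytically on `z`, so that `T(z)` intertwines `P(z)` and `P(z₀)` and `T A T⁻¹` is block diagonal,
with blocks `F(z)` on the finite-dimensional space `ran P(z₀)` and an invertible one on the
complement. Hence `A` is analytically equivalent to `F ⊕ 1` near `z₀` (`exists_isFiniteBlock`).
Such an equivalence survives the division of both sides by the elementary factors along the ranges
at `z₀` (`AnalyticEquivAt.of_elemFactor_mul`), and on the side of `F ⊕ 1` the division takes place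
in `F`: it removes from `det F` a factor `± (z - z₀) ^ d`, where `d = dim ker A(z₀)` is the rank of
`P`. When the operator side has become invertible, so has the finite block, and its determinant does
not vanish at `z₀`. Therefore the order of `det F` is the sum of the ranks.
-/

noncomputable section

namespace Howland

/-! ### Perturbations of finite rank -/

section FiniteRank

variable {H : Type*} [NormedAddCommGroup H] [InnerProductSpace ℂ H]

theorem isFiniteRank_iff_hasFiniteRange {T : H →L[ℂ] H} :
    IsFiniteRank T ↔ T.toLinearMap.HasFiniteRange :=
  (Submodule.fg_iff_finiteDimensional _).symm

theorem IsFiniteRank.add {S T : H →L[ℂ] H} (hS : IsFiniteRank S) (hT : IsFiniteRank T) :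
    IsFiniteRank (S + T) := by
  rw [isFiniteRank_iff_hasFiniteRange] at *
  exact hS.add hT

theorem IsFiniteRank.neg {T : H →L[ℂ] H} (hT : IsFiniteRank T) : IsFiniteRank (-T) := by
  rw [isFiniteRank_iff_hasFiniteRange] at *
  exact LinearMap.HasFiniteRange.neg hT

theorem IsFiniteRank.mul_right {S : H →L[ℂ] H} (hS : IsFiniteRank S) (T : H →L[ℂ] H) :
    IsFiniteRank (S * T) := by
  rw [isFiniteRank_iff_hasFiniteRange] at *
  exact LinearMap.HasFiniteRange.comp_right hS T.toLinearMap

theorem IsFiniteRank.smul {S : H →L[ℂ] H} (hS : IsFiniteRank S) (c : ℂ) :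
    IsFiniteRank (c • S) := by
  rw [isFiniteRank_iff_hasFiniteRange] at *
  exact LinearMap.HasFiniteRange.smul hS c

theorem IsFiniteRank.isCompactOperator {T : H →L[ℂ] H} (hT : IsFiniteRank T) :
    IsCompactOperator T := by
  have : FiniteDimensional ℂ T.range := hT
  have : ProperSpace T.range := FiniteDimensional.proper ℂ T.range
  have h : IsCompactOperator (T.codRestrict T.range fun x => ⟨x, rfl⟩) :=
    isCompactOperator_of_locallyCompactSpace_dom _
  exact h.clm_comp T.range.subtypeL

open LinearMap.FiniteRangeSetoid in
theorem isFredholm_of_isFiniteRank_sub {S T : H →L[ℂ] H} (hS : S.IsFredholm)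
    (h : IsFiniteRank (S - T)) : T.IsFredholm := by
  obtain ⟨v, hv⟩ := hS.exists_isQuasiInverse
  have hST : S.toLinearMap ≈ T.toLinearMap :=
    LinearMap.FiniteRangeSetoid.equiv_iff_hasFiniteRange.2 (isFiniteRank_iff_hasFiniteRange.1 h)
  refine .of_isQuasiInverse (v := v) ⟨?_, ?_⟩
  · exact Setoid.trans (LinearMap.FiniteRangeSetoid.equiv_comp_left (Setoid.symm hST)) hv.1
  · exact Setoid.trans (LinearMap.FiniteRangeSetoid.equiv_comp_right (Setoid.symm hST)) hv.2

theorem singularNumber_nonneg (T : H →L[ℂ] H) (n : ℕ) : 0 ≤ singularNumber T n := by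
  refine Real.sInf_nonneg ?_
  rintro r ⟨F, -, -, rfl⟩
  exact norm_nonneg _

/-- A perturbation of finite rank `r` shifts the singular numbers by at most `r` places. -/
theorem singularNumber_add_le (T : H →L[ℂ] H) {F : H →L[ℂ] H} (hF : IsFiniteRank F) (n : ℕ) :
    singularNumber (T + F) (n + Module.finrank ℂ F.range) ≤ singularNumber T n := by
  refine le_csInf ⟨_, 0, ?_, ?_, rfl⟩ ?_
  · rw [isFiniteRank_iff_hasFiniteRange]; exact LinearMap.HasFiniteRange.zero
  · have h0 : (0 : H →L[ℂ] H).range = ⊥ := LinearMap.range_zero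
    rw [h0, finrank_bot]
    exact n.zero_le
  rintro r ⟨G, hG, hGn, rfl⟩
  refine csInf_le ⟨0, ?_⟩ ⟨G + F, hG.add hF, ?_, by congr 1; abel⟩
  · rintro r ⟨F, -, -, rfl⟩
    exact norm_nonneg _
  · have : FiniteDimensional ℂ G.range := hG
    have : FiniteDimensional ℂ F.range := hF
    have h1 : (G + F).range ≤ G.range ⊔ F.range := LinearMap.range_add_le _ _
    have h2 := Submodule.finrank_mono h1
    have h3 := Submodule.finrank_add_le_finrank_add_finrank G.range F.range
    omega

theorem IsSchatten.add_isFiniteRank {p : ℝ≥0∞} {T F : H →L[ℂ] H} (hT : IsSchatten p T)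
    (hF : IsFiniteRank F) : IsSchatten p (T + F) := by
  rcases hT with ⟨hp, hT⟩ | ⟨hp, hT⟩
  · exact Or.inl ⟨hp, hT.add hF.isCompactOperator⟩
  · refine Or.inr ⟨hp, (summable_nat_add_iff (Module.finrank ℂ F.range)).1 ?_⟩
    refine Summable.of_nonneg_of_le (fun n => ?_) (fun n => ?_) hT
    · exact Real.rpow_nonneg (singularNumber_nonneg _ _) _
    · exact Real.rpow_le_rpow (singularNumber_nonneg _ _) (singularNumber_add_le T hF n)
        ENNReal.toReal_nonneg

theorem isSchatten_iff_of_isFiniteRank_sub {p : ℝ≥0∞} {S T : H →L[ℂ] H}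
    (h : IsFiniteRank (S - T)) : IsSchatten p (1 - S) ↔ IsSchatten p (1 - T) := by
  constructor <;> intro hS
  · simpa using hS.add_isFiniteRank h
  · simpa using hS.add_isFiniteRank h.neg

theorem isFiniteRank_iff_of_isFiniteRank_sub {S T : H →L[ℂ] H}
    (h : IsFiniteRank (S - T)) : IsFiniteRank (1 - S) ↔ IsFiniteRank (1 - T) := by
  constructor <;> intro hS
  · simpa using hS.add h
  · simpa using hS.add h.neg

variable [CompleteSpace H]

/-- A Fredholm operator which is a limit of invertible operators has index zero: if `S` is an
invertible operator close to `T`, then `(x, c) ↦ S x + c` is an isomorphism from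
`(ker T)ᗮ × (ran T)ᗮ` onto `H`, as it is for `S = T`, and comparing it with `S` identifies
`(ran T)ᗮ` with `ker T`. -/
theorem finrank_ker_eq_of_mem_closure_isUnit {T : H →L[ℂ] H} (hT : T.IsFredholm)
    (h : T ∈ closure {S : H →L[ℂ] H | IsUnit S}) :
    Module.finrank ℂ T.ker = Module.finrank ℂ (T.range)ᗮ := by
  have := hT.finite_ker
  have : CompleteSpace T.range := hT.isClosed_range.completeSpace_coe
  let Φ : (H →L[ℂ] H) → ((T.kerᗮ × (T.range)ᗮ : Type _) →L[ℂ] H) := fun S =>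
    (S ∘L (T.kerᗮ).subtypeL).coprod ((T.range)ᗮ).subtypeL
  have hΦc : Continuous Φ := by
    have : Φ = fun S => (S ∘L (T.kerᗮ).subtypeL) ∘L ContinuousLinearMap.fst ℂ _ _ +
        ((T.range)ᗮ).subtypeL ∘L ContinuousLinearMap.snd ℂ _ _ := by
      ext S x <;> simp [Φ]
    rw [this]
    fun_prop
  have hbij : Function.Bijective (Φ T) := by
    constructor
    · refine (injective_iff_map_eq_zero _).2 ?_
      rintro ⟨⟨x, hx⟩, ⟨c, hc⟩⟩ hxc
      have h1 : T x + c = 0 := by simpa [Φ] using hxc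
      have h2 : c ∈ T.range :=
        ⟨-x, by simpa [eq_neg_iff_add_eq_zero, neg_eq_iff_add_eq_zero] using h1⟩
      have h3 : c = 0 := by
        have := Submodule.inner_right_of_mem_orthogonal h2 hc
        simpa using this
      subst h3
      have h4 : x ∈ T.ker := by simpa using h1
      have h5 : x = 0 := by
        have := Submodule.inner_right_of_mem_orthogonal h4 hx
        simpa using this
      subst h5
      rfl
    · intro y
      obtain ⟨v, hv, c, hc, rfl⟩ := T.range.exists_add_mem_mem_orthogonal y
      obtain ⟨u, rfl⟩ := hv
      obtain ⟨k, hk, x, hx, rfl⟩ := T.ker.exists_add_mem_mem_orthogonal u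
      have hk' : T k = 0 := hk
      exact ⟨(⟨x, hx⟩, ⟨c, hc⟩), by simp [Φ, hk']⟩
  let e₀ : (T.kerᗮ × (T.range)ᗮ : Type _) ≃L[ℂ] H := ContinuousLinearEquiv.ofBijective (Φ T)
    (LinearMap.ker_eq_bot.2 hbij.1) (LinearMap.range_eq_top.2 hbij.2)
  have hopen := (ContinuousLinearEquiv.isOpen (𝕜 := ℂ) (E := (T.kerᗮ × (T.range)ᗮ : Type _))
    (F := H)).preimage hΦc
  obtain ⟨S, ⟨e, he⟩, hS⟩ := mem_closure_iff.1 h _ hopen ⟨e₀, by ext x <;> rfl⟩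
  obtain ⟨u, rfl⟩ := hS
  have hinv : ∀ x, (↑u⁻¹ : H →L[ℂ] H) ((u : H →L[ℂ] H) x) = x := fun x => congr($(u.inv_mul) x)
  have hinv' : ∀ x, (u : H →L[ℂ] H) ((↑u⁻¹ : H →L[ℂ] H) x) = x := fun x => congr($(u.mul_inv) x)
  have he' : ∀ x c, e (x, c) = (u : H →L[ℂ] H) x + c := by
    intro x c
    have : e (x, c) = Φ u (x, c) := congr($he (x, c))
    simpa [Φ] using this
  -- the component in `ker T` of the operator which `S⁻¹` induces on `(ran T)ᗮ`
  let g : (T.range)ᗮ →ₗ[ℂ] T.ker :=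
    T.ker.orthogonalProjectionOnto.toLinearMap ∘ₗ (↑u⁻¹ : H →L[ℂ] H).toLinearMap ∘ₗ
      ((T.range)ᗮ).subtype
  refine (LinearEquiv.finrank_eq (LinearEquiv.ofBijective g ⟨?_, ?_⟩)).symm
  · refine (injective_iff_map_eq_zero _).2 fun c hc => ?_
    have h1 : (↑u⁻¹ : H →L[ℂ] H) c ∈ T.kerᗮ :=
      Submodule.orthogonalProjectionOnto_eq_zero_iff.1 hc
    have h2 : e (⟨_, h1⟩, 0) = e (0, c) := by rw [he', he']; simp [hinv']
    simpa using (congr($(e.injective h2).2)).symm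
  · intro k
    obtain ⟨⟨x, c⟩, hxc⟩ := e.surjective ((u : H →L[ℂ] H) k)
    refine ⟨c, ?_⟩
    have h1 : (↑u⁻¹ : H →L[ℂ] H) c = k - x := by
      rw [he', ← eq_sub_iff_add_eq'] at hxc
      rw [hxc, map_sub, hinv, hinv]
    have h2 : T.ker.orthogonalProjectionOnto (x : H) = 0 :=
      Submodule.orthogonalProjectionOnto_eq_zero_iff.2 x.2
    simp [g, h1, h2]

theorem index_eq_zero_of_mem_closure_isUnit {T : H →L[ℂ] H} (hT : T.IsFredholm)
    (h : T ∈ closure {S : H →L[ℂ] H | IsUnit S}) : index T = 0 := by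
  rw [index, finrank_ker_eq_of_mem_closure_isUnit hT h, ContinuousLinearMap.orthogonal_range,
    sub_self]

theorem index_of_isUnit {T : H →L[ℂ] H} (hT : IsUnit T) : index T = 0 := by
  have h1 : ∀ S : H →L[ℂ] H, IsUnit S → S.ker = ⊥ := by
    rintro S ⟨u, rfl⟩
    refine LinearMap.ker_eq_bot'.2 fun x hx => ?_
    have := congr($(u.inv_mul) x)
    simp only [mul_apply_eq_comp, one_apply_eq_self] at this
    rw [← this, show (u : H →L[ℂ] H) x = 0 from hx, map_zero]
  have h2 : IsUnit (ContinuousLinearMap.adjoint T) := by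
    simpa [ContinuousLinearMap.star_eq_adjoint] using hT.star
  rw [index, h1 T hT, h1 _ h2]
  simp

end FiniteRank

/-! ### Division by elementary factors -/

section Factor

variable {E : Type*} [NormedAddCommGroup E] [NormedSpace ℂ E]

/-- The elementary factor `Q - w P`, where `Q = 1 - P`. -/
def elemFactor (P : E →L[ℂ] E) (w : ℂ) : E →L[ℂ] E := (1 - P) - w • P

theorem elemFactor_mul_inv {P : E →L[ℂ] E} (hP : IsIdempotentElem P) {w : ℂ} (hw : w ≠ 0) :
    elemFactor P w * elemFactor P w⁻¹ = 1 := by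
  have h : P * P = P := hP
  have h1 : (1 - P) * (1 - P) = 1 - P := hP.one_sub
  rw [elemFactor, elemFactor, sub_mul, mul_sub (1 - P), mul_sub (w • P), h1, mul_smul_comm,
    smul_mul_assoc, smul_mul_assoc, mul_smul_comm, smul_smul, mul_inv_cancel₀ hw, one_smul, h,
    hP.one_sub_mul_self, hP.mul_one_sub_self, smul_zero, smul_zero]
  abel

theorem isUnit_elemFactor {P : E →L[ℂ] E} (hP : IsIdempotentElem P) {w : ℂ} (hw : w ≠ 0) :
    IsUnit (elemFactor P w) :=
  ⟨⟨_, _, elemFactor_mul_inv hP hw, by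
    simpa using elemFactor_mul_inv hP (inv_ne_zero hw)⟩, rfl⟩

theorem analyticAt_elemFactor (P : E →L[ℂ] E) (z₀ z : ℂ) :
    AnalyticAt ℂ (fun z => elemFactor P (z - z₀)) z := by
  unfold elemFactor
  fun_prop

/-- `P` is a projection with kernel `ran T`, so that `ran P` is a complement of `ran T`. -/
structure IsCokernelProj (P T : E →L[ℂ] E) : Prop where
  isIdempotentElem : IsIdempotentElem P
  mul_eq_zero : P * T = 0
  exists_apply_eq : ∀ x, ∃ y, T y = x - P x

/-- An operator which vanishes on `ran T` vanishes on the range of `1 - P`, which is `ran T`. -/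
theorem IsCokernelProj.mul_one_sub_eq_zero {P T : E →L[ℂ] E} (h : IsCokernelProj P T)
    {F : Type*} [NormedAddCommGroup F] [NormedSpace ℂ F]
    {X : E →L[ℂ] F} (hX : X ∘L T = 0) : X ∘L (1 - P) = 0 := by
  ext x
  obtain ⟨y, hy⟩ := h.exists_apply_eq x
  have := congr($hX y)
  simpa [hy] using this

/-- The quotient of `Y` by the elementary factor `Q - (z - z₀) P` on the left, for `P Y(z₀) = 0`:
`Q Y(z) - P (Y(z) - Y(z₀)) / (z - z₀)`. -/
def divFactor (P : E →L[ℂ] E) (z₀ : ℂ) (Y : ℂ → E →L[ℂ] E) (z : ℂ) : E →L[ℂ] E :=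
  (1 - P) * Y z - P * dslope Y z₀ z

theorem elemFactor_mul_divFactor {P : E →L[ℂ] E} (hP : IsIdempotentElem P) {z₀ : ℂ}
    {Y : ℂ → E →L[ℂ] E} (hY : P * Y z₀ = 0) (z : ℂ) :
    elemFactor P (z - z₀) * divFactor P z₀ Y z = Y z := by
  have h : P * P = P := hP
  have h1 : P * Y z = (z - z₀) • (P * dslope Y z₀ z) := by
    rw [← mul_smul_comm, sub_smul_dslope, mul_sub, hY, sub_zero]
  have h2 : (1 - P) * (1 - P) = 1 - P := hP.one_sub
  rw [elemFactor, divFactor, sub_mul, mul_sub, mul_sub, ← mul_assoc, ← mul_assoc, smul_mul_assoc,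
    smul_mul_assoc, ← mul_assoc, ← mul_assoc, h, h2, hP.one_sub_mul_self, hP.mul_one_sub_self,
    ← h1, zero_mul, zero_mul, smul_zero, sub_mul, one_mul]
  abel

theorem analyticAt_dslope {F : Type*} [NormedAddCommGroup F] [NormedSpace ℂ F]
    {f : ℂ → F} {z₀ : ℂ} (hf : AnalyticAt ℂ f z₀) :
    AnalyticAt ℂ (dslope f z₀) z₀ := by
  obtain ⟨p, hp⟩ := hf
  exact ⟨_, hp.has_fpower_series_dslope_fslope⟩

theorem analyticAt_divFactor (P : E →L[ℂ] E) {z₀ : ℂ}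
    {Y : ℂ → E →L[ℂ] E} (hY : AnalyticAt ℂ Y z₀) : AnalyticAt ℂ (divFactor P z₀ Y) z₀ := by
  have := analyticAt_dslope hY
  unfold divFactor
  fun_prop

theorem analyticOnNhd_divFactor (P : E →L[ℂ] E) {z₀ : ℂ} [CompleteSpace E] {Ω : Set ℂ}
    (hΩ : IsOpen Ω) (hz₀ : z₀ ∈ Ω)
    {Y : ℂ → E →L[ℂ] E} (hY : AnalyticOnNhd ℂ Y Ω) : AnalyticOnNhd ℂ (divFactor P z₀ Y) Ω := by
  have h : AnalyticOnNhd ℂ (dslope Y z₀) Ω :=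
    ((Complex.differentiableOn_dslope (hΩ.mem_nhds hz₀)).2 hY.differentiableOn).analyticOnNhd hΩ
  intro z hz
  have h1 := h z hz
  have h2 := hY z hz
  unfold divFactor
  fun_prop

/-- Two functions continuous at `z₀` which agree after multiplication by an elementary factor
agree near `z₀`. -/
theorem eventuallyEq_of_elemFactor_mul {P : E →L[ℂ] E} (hP : IsIdempotentElem P) {z₀ : ℂ}
    {f g : ℂ → E →L[ℂ] E} (hf : ContinuousAt f z₀) (hg : ContinuousAt g z₀)
    (h : ∀ᶠ z in 𝓝 z₀, elemFactor P (z - z₀) * f z = elemFactor P (z - z₀) * g z) :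
    f =ᶠ[𝓝 z₀] g := by
  refine (hf.eventuallyEq_nhds_iff_eventuallyEq_nhdsNE hg).1 ?_
  filter_upwards [h.filter_mono nhdsWithin_le_nhds, self_mem_nhdsWithin] with z hz hne
  exact (isUnit_elemFactor hP (sub_ne_zero.2 hne)).mul_left_cancel hz

theorem analyticAt_ringInverse [CompleteSpace E] {A : ℂ → E →L[ℂ] E} {z₀ : ℂ}
    (hA : AnalyticAt ℂ A z₀) (h : IsUnit (A z₀)) :
    AnalyticAt ℂ (fun z => Ring.inverse (A z)) z₀ := by
  obtain ⟨u, hu⟩ := h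
  have h1 : AnalyticAt ℂ Ring.inverse (A z₀) := hu ▸ analyticAt_inverse (𝕜 := ℂ) u
  exact h1.comp hA

theorem eventually_isUnit [CompleteSpace E] {A : ℂ → E →L[ℂ] E} {z₀ : ℂ}
    (hA : ContinuousAt A z₀) (h : IsUnit (A z₀)) : ∀ᶠ z in 𝓝 z₀, IsUnit (A z) :=
  hA (Units.isOpen.mem_nhds h)

end Factor

section Pole

variable {H : Type*} [NormedAddCommGroup H] [InnerProductSpace ℂ H]

theorem exists_isCokernelProj (T : H →L[ℂ] H) [T.range.HasOrthogonalProjection] :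
    ∃ P : H →L[ℂ] H, IsCokernelProj P T ∧ P.range = (T.range)ᗮ := by
  refine ⟨(T.range)ᗮ.starProjection, ⟨Submodule.isIdempotentElem_starProjection _, ?_, ?_⟩, ?_⟩
  · ext x
    have : T.range.starProjection (T x) = T x :=
      Submodule.starProjection_eq_self_iff.2 ⟨x, rfl⟩
    simp [Submodule.starProjection_orthogonal, this]
  · intro x
    have : x - (T.range)ᗮ.starProjection x ∈ T.range := by
      simp [Submodule.starProjection_orthogonal]
    exact this
  · exact Submodule.range_starProjection _

variable [CompleteSpace H]

/-- If `A(z)⁻¹` has order exactly `0` at `z₀`, then its limit there is an inverse of `A(z₀)`. -/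
theorem InverseHasPole.isUnit_of_zero {A : ℂ → H →L[ℂ] H} {z₀ : ℂ} (hA : ContinuousAt A z₀)
    (h : InverseHasPole A z₀ 0) : IsUnit (A z₀) := by
  obtain ⟨h1, h2, h3⟩ := h
  obtain ⟨g, hg, -, hge⟩ := (meromorphicOrderAt_eq_int_iff h2).1 h3
  have hgA : (fun z => g z * A z) =ᶠ[𝓝 z₀] fun _ => 1 := by
    refine ((hg.continuousAt.mul hA).eventuallyEq_nhds_iff_eventuallyEq_nhdsNE
      continuousAt_const).1 ?_
    filter_upwards [h1, hge] with z hz hz'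
    have : g z = Ring.inverse (A z) := by simpa using hz'.symm
    rw [Pi.mul_apply, this, Ring.inverse_mul_cancel _ hz]
  have hAg : (fun z => A z * g z) =ᶠ[𝓝 z₀] fun _ => 1 := by
    refine ((hA.mul hg.continuousAt).eventuallyEq_nhds_iff_eventuallyEq_nhdsNE
      continuousAt_const).1 ?_
    filter_upwards [h1, hge] with z hz hz'
    have : g z = Ring.inverse (A z) := by simpa using hz'.symm
    rw [Pi.mul_apply, this, Ring.mul_inverse_cancel _ hz]
  exact ⟨⟨_, _, hAg.self_of_nhds, hgA.self_of_nhds⟩, rfl⟩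

/-- Dividing by the elementary factor along the range of `A(z₀)` lowers the order of the pole of
the inverse by exactly one, and the projection is not zero: the leading coefficient `g(z₀)` of
`A(z)⁻¹` satisfies `g(z₀) A(z₀) = 0`, hence `g(z₀) = g(z₀) P`. -/
theorem InverseHasPole.of_elemFactor_mul {A B : ℂ → H →L[ℂ] H} {z₀ : ℂ} {n : ℕ}
    {P : H →L[ℂ] H} (hA : ContinuousAt A z₀) (h : InverseHasPole A z₀ (n + 1))
    (hP : IsCokernelProj P (A z₀)) (hB : ∀ᶠ z in 𝓝 z₀, A z = elemFactor P (z - z₀) * B z) :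
    P ≠ 0 ∧ InverseHasPole B z₀ n := by
  obtain ⟨h1, h2, h3⟩ := h
  obtain ⟨g, hg, hg0, hge⟩ := (meromorphicOrderAt_eq_int_iff h2).1 h3
  have hPP : P * P = P := hP.isIdempotentElem
  have hgA : (fun z => g z * A z) =ᶠ[𝓝 z₀] fun z => (z - z₀) ^ (n + 1) • (1 : H →L[ℂ] H) := by
    refine ((hg.continuousAt.mul hA).eventuallyEq_nhds_iff_eventuallyEq_nhdsNE
      (by fun_prop)).1 ?_
    filter_upwards [h1, hge, self_mem_nhdsWithin] with z hz hz' hne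
    have hne' : z - z₀ ≠ 0 := sub_ne_zero.2 hne
    have : g z = (z - z₀) ^ (n + 1) • Ring.inverse (A z) := by
      rw [hz', smul_smul, zpow_neg, ← zpow_natCast, mul_inv_cancel₀ (zpow_ne_zero _ hne'), one_smul]
    rw [Pi.mul_apply, this, smul_mul_assoc, Ring.inverse_mul_cancel _ hz]
  have hgA0 : g z₀ * A z₀ = 0 := by simpa using hgA.self_of_nhds
  have hgQ : g z₀ * (1 - P) = 0 := hP.mul_one_sub_eq_zero hgA0
  have hgP : g z₀ = g z₀ * P := by rw [mul_sub, mul_one, sub_eq_zero] at hgQ; exact hgQ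
  have hP0 : P ≠ 0 := by
    rintro rfl
    exact hg0 (by simpa using hgP)
  -- `g(z) (Q - (z - z₀) P) = (z - z₀) k(z)`, since `g(z₀) Q = 0`
  let k : ℂ → H →L[ℂ] H := fun z => dslope (fun z => g z * (1 - P)) z₀ z - g z * P
  have hgQa : AnalyticAt ℂ (fun z => g z * (1 - P)) z₀ := hg.mul analyticAt_const
  have hk : AnalyticAt ℂ k z₀ := (analyticAt_dslope hgQa).sub (hg.mul analyticAt_const)
  have hk0 : k z₀ ≠ 0 := by
    intro h0
    -- multiplication by `P` from the right removes the derivative term, as `(1 - P) P = 0`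
    have e1 : k z₀ * P = -(g z₀ * P) := by
      have hd : deriv (fun z => g z * (1 - P)) z₀ = deriv g z₀ * (1 - P) :=
        (hg.differentiableAt.hasDerivAt.mul_const (1 - P)).deriv
      simp only [k, dslope_same, hd]
      simp only [sub_mul, mul_sub, mul_one, mul_assoc, hPP]
      abel
    rw [h0, zero_mul, ← hgP, eq_comm, neg_eq_zero] at e1
    exact hg0 e1
  have hunit : ∀ᶠ z in 𝓝[≠] z₀, IsUnit (B z) ∧
      Ring.inverse (B z) = Ring.inverse (A z) * elemFactor P (z - z₀) := by
    filter_upwards [h1, hB.filter_mono nhdsWithin_le_nhds, self_mem_nhdsWithin] with z hz hz' hne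
    have hN := isUnit_elemFactor hP.isIdempotentElem (sub_ne_zero.2 hne)
    have hBz : IsUnit (B z) := by
      rw [hz'] at hz
      obtain ⟨N, hN⟩ := hN
      rwa [← hN, Units.isUnit_units_mul] at hz
    refine ⟨hBz, ?_⟩
    obtain ⟨b, hb⟩ := hBz
    obtain ⟨N, hN⟩ := hN
    rw [hz', ← hb, ← hN, ← Units.val_mul, Ring.inverse_unit, Ring.inverse_unit, ← Units.val_mul]
    simp
  have hexp : ∀ᶠ z in 𝓝[≠] z₀, Ring.inverse (B z) = (z - z₀) ^ (-(n : ℤ)) • k z := by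
    filter_upwards [hunit, hge, self_mem_nhdsWithin] with z hz hz' hne
    have hne' : z - z₀ ≠ 0 := sub_ne_zero.2 hne
    have e2 : g z * (1 - P) = (z - z₀) • dslope (fun z => g z * (1 - P)) z₀ z := by
      rw [sub_smul_dslope, hgQ, sub_zero]
    have e3 : (z - z₀) ^ (-(n : ℤ)) = (z - z₀) ^ (-((n + 1 : ℕ) : ℤ)) * (z - z₀) := by
      rw [← zpow_add_one₀ hne']; congr 1; push_cast; ring
    rw [hz.2, hz', e3, mul_smul, smul_mul_assoc]
    congr 1
    rw [elemFactor, mul_sub, mul_smul_comm, e2, ← smul_sub]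
  have hmero : MeromorphicAt (fun z => Ring.inverse (B z)) z₀ := by
    refine MeromorphicAt.congr ?_ (hexp.mono fun z hz => hz.symm)
    have : MeromorphicAt (fun z : ℂ => (z - z₀) ^ (-(n : ℤ))) z₀ :=
      MeromorphicAt.zpow (by fun_prop) _
    exact this.smul hk.meromorphicAt
  exact ⟨hP0, hunit.mono fun z hz => hz.1, hmero,
    (meromorphicOrderAt_eq_int_iff hmero).2 ⟨k, hk, hk0, hexp⟩⟩

end Pole

/-! ### Determinants on finite-dimensional spaces -/

theorem det_elemFactor {W : Type*} [NormedAddCommGroup W] [NormedSpace ℂ W]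
    [FiniteDimensional ℂ W] {P : W →L[ℂ] W} (hP : IsIdempotentElem P) (w : ℂ) :
    LinearMap.det (elemFactor P w).toLinearMap = (-w) ^ Module.finrank ℂ P.range := by
  have hc : IsCompl P.range P.ker :=
    LinearMap.IsIdempotentElem.isCompl (congrArg ContinuousLinearMap.toLinearMap hP)
  let e := Submodule.prodEquivOfIsCompl _ _ hc
  have h : (elemFactor P w).toLinearMap = e.toLinearMap ∘ₗ
      (LinearMap.prodMap ((-w) • LinearMap.id) LinearMap.id) ∘ₗ e.symm.toLinearMap := by
    rw [← LinearMap.comp_assoc, LinearEquiv.eq_comp_toLinearMap_symm]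
    ext ⟨x, hx⟩
    · obtain ⟨y, rfl⟩ := hx
      have : P (P y) = P y := congr($hP y)
      simp [e, elemFactor, this]
    · have : P x = 0 := hx
      simp [e, elemFactor, this]
  rw [h, LinearMap.det_conj, LinearMap.det_prodMap]
  simp

theorem analyticAt_det {W : Type*} [NormedAddCommGroup W] [NormedSpace ℂ W]
    [FiniteDimensional ℂ W] {F : ℂ → W →L[ℂ] W} {z₀ : ℂ} (hF : AnalyticAt ℂ F z₀) :
    AnalyticAt ℂ (fun z => LinearMap.det (F z).toLinearMap) z₀ := by
  let b := Module.finBasis ℂ W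
  have h : (fun z => LinearMap.det (F z).toLinearMap) = fun z => ∑ σ : Equiv.Perm _,
      ((Equiv.Perm.sign σ : ℤ) : ℂ) * ∏ i, (b.coord (σ i)).toContinuousLinearMap (F z (b i)) := by
    ext z
    rw [← LinearMap.det_toMatrix b, Matrix.det_apply']
    simp [LinearMap.toMatrix_apply]
  rw [h]
  refine Finset.analyticAt_fun_sum _ fun σ _ => analyticAt_const.mul ?_
  refine Finset.analyticAt_fun_prod _ fun i _ => ?_
  have h1 : AnalyticAt ℂ (fun z => F z (b i)) z₀ :=
    ((ContinuousLinearMap.apply ℂ W (b i)).analyticAt _).comp hF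
  exact ((b.coord (σ i)).toContinuousLinearMap.analyticAt _).comp h1

/-! ### Analytic equivalence and finite blocks -/

variable {H : Type*} [NormedAddCommGroup H] [InnerProductSpace ℂ H]

/-- Near `z₀` the operator functions `A` and `D` agree up to multiplication from the left and
from the right by analytic functions with invertible values. -/
def AnalyticEquivAt (A D : ℂ → H →L[ℂ] H) (z₀ : ℂ) : Prop :=
  ∃ T G : ℂ → H →L[ℂ] H, AnalyticAt ℂ T z₀ ∧ AnalyticAt ℂ G z₀ ∧ IsUnit (T z₀) ∧ IsUnit (G z₀) ∧
    ∀ᶠ z in 𝓝 z₀, T z * A z * G z = D z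

theorem finrank_ker_mul_mul {T A G : H →L[ℂ] H} (hT : IsUnit T) (hG : IsUnit G) :
    Module.finrank ℂ (T * A * G).ker = Module.finrank ℂ A.ker := by
  obtain ⟨T, rfl⟩ := hT
  obtain ⟨G, rfl⟩ := hG
  have h1 : ∀ x, (↑T⁻¹ : H →L[ℂ] H) ((T : H →L[ℂ] H) x) = x := fun x => congr($(T.inv_mul) x)
  have h2 : ∀ x, (G : H →L[ℂ] H) ((↑G⁻¹ : H →L[ℂ] H) x) = x := fun x => congr($(G.mul_inv) x)
  have h3 : ∀ x, (↑G⁻¹ : H →L[ℂ] H) ((G : H →L[ℂ] H) x) = x := fun x => congr($(G.inv_mul) x)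
  refine LinearEquiv.finrank_eq
    { toFun := fun x => ⟨(G : H →L[ℂ] H) x, ?_⟩
      invFun := fun x => ⟨(↑G⁻¹ : H →L[ℂ] H) x, ?_⟩
      map_add' := fun x y => Subtype.ext (map_add (G : H →L[ℂ] H) (x : H) y)
      map_smul' := fun c x => Subtype.ext (map_smul (G : H →L[ℂ] H) c (x : H))
      left_inv := fun x => by ext; simp [h3]
      right_inv := fun x => by ext; simp [h2] }
  · have hx : (T : H →L[ℂ] H) (A ((G : H →L[ℂ] H) x)) = 0 := x.2
    have := congrArg (↑T⁻¹ : H →L[ℂ] H) hx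
    rwa [h1, map_zero] at this
  · have hx : A x = 0 := x.2
    change (T : H →L[ℂ] H) (A ((G : H →L[ℂ] H) ((↑G⁻¹ : H →L[ℂ] H) x))) = 0
    rw [h2, hx, map_zero]

variable [CompleteSpace H]

/-- Equivalence persists after dividing out on both sides an elementary factor along the range:
if `T A G = D`, `A = N A₁`, `D = N' D₁`, then `T₁ = N'⁻¹ T N` has a removable singularity, because
`T(z₀)` maps `ran A(z₀)` onto `ran D(z₀)`, and so has its inverse. -/
theorem AnalyticEquivAt.of_elemFactor_mul {A D A₁ D₁ : ℂ → H →L[ℂ] H} {z₀ : ℂ}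
    (h : AnalyticEquivAt A D z₀) {P P' : H →L[ℂ] H} (hP : IsCokernelProj P (A z₀))
    (hP' : IsCokernelProj P' (D z₀)) (hA₁ : ContinuousAt A₁ z₀) (hD₁ : ContinuousAt D₁ z₀)
    (hA : ∀ᶠ z in 𝓝 z₀, A z = elemFactor P (z - z₀) * A₁ z)
    (hD : ∀ᶠ z in 𝓝 z₀, D z = elemFactor P' (z - z₀) * D₁ z) : AnalyticEquivAt A₁ D₁ z₀ := by
  obtain ⟨T, G, hT, hG, hTu, hGu, hTG⟩ := h
  let S : ℂ → H →L[ℂ] H := fun z => Ring.inverse (T z)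
  have hS : AnalyticAt ℂ S z₀ := analyticAt_ringInverse hT hTu
  have hTS : ∀ᶠ z in 𝓝 z₀, T z * S z = 1 ∧ S z * T z = 1 :=
    (eventually_isUnit hT.continuousAt hTu).mono fun z hz =>
      ⟨Ring.mul_inverse_cancel _ hz, Ring.inverse_mul_cancel _ hz⟩
  have hTG0 := hTG.self_of_nhds
  have hST0 := hTS.self_of_nhds.2
  have hN := analyticAt_elemFactor P z₀ z₀
  have hN' := analyticAt_elemFactor P' z₀ z₀
  -- `T(z₀)` maps `ran A(z₀)` into `ran D(z₀)`, and `T(z₀)⁻¹` maps it back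
  have e1 : P' * (T z₀ * elemFactor P (z₀ - z₀)) = 0 := by
    have : (P' * T z₀) * A z₀ = 0 := by
      refine hGu.mul_right_cancel ?_
      rw [zero_mul, mul_assoc, mul_assoc, ← mul_assoc (T z₀), hTG0, hP'.mul_eq_zero]
    have : (P' * T z₀) * (1 - P) = 0 := hP.mul_one_sub_eq_zero this
    simpa [elemFactor, mul_assoc] using this
  have e2 : P * (S z₀ * elemFactor P' (z₀ - z₀)) = 0 := by
    have : (P * S z₀) * D z₀ = 0 := by
      rw [← hTG0, mul_assoc, ← mul_assoc (S z₀), ← mul_assoc (S z₀), hST0, one_mul, ← mul_assoc,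
        hP.mul_eq_zero, zero_mul]
    have : (P * S z₀) * (1 - P') = 0 := hP'.mul_one_sub_eq_zero this
    simpa [elemFactor, mul_assoc] using this
  let T₁ := divFactor P' z₀ fun z => T z * elemFactor P (z - z₀)
  let S₁ := divFactor P z₀ fun z => S z * elemFactor P' (z - z₀)
  have hT₁ : AnalyticAt ℂ T₁ z₀ := analyticAt_divFactor _ (hT.mul hN)
  have hS₁ : AnalyticAt ℂ S₁ z₀ := analyticAt_divFactor _ (hS.mul hN')
  have eT : ∀ z, elemFactor P' (z - z₀) * T₁ z = T z * elemFactor P (z - z₀) :=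
    elemFactor_mul_divFactor hP'.isIdempotentElem e1
  have eS : ∀ z, elemFactor P (z - z₀) * S₁ z = S z * elemFactor P' (z - z₀) :=
    elemFactor_mul_divFactor hP.isIdempotentElem e2
  have hTS₁ : (fun z => T₁ z * S₁ z) =ᶠ[𝓝 z₀] fun _ => 1 := by
    refine eventuallyEq_of_elemFactor_mul hP'.isIdempotentElem
      (hT₁.mul hS₁).continuousAt continuousAt_const ?_
    filter_upwards [hTS] with z hz
    rw [← mul_assoc, eT, mul_assoc, eS, ← mul_assoc, hz.1, one_mul, mul_one]
  have hST₁ : (fun z => S₁ z * T₁ z) =ᶠ[𝓝 z₀] fun _ => 1 := by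
    refine eventuallyEq_of_elemFactor_mul hP.isIdempotentElem
      (hS₁.mul hT₁).continuousAt continuousAt_const ?_
    filter_upwards [hTS] with z hz
    rw [← mul_assoc, eS, mul_assoc, eT, ← mul_assoc, hz.2, one_mul, mul_one]
  refine ⟨T₁, G, hT₁, hG, ⟨⟨_, _, hTS₁.self_of_nhds, hST₁.self_of_nhds⟩, rfl⟩, hGu, ?_⟩
  refine eventuallyEq_of_elemFactor_mul hP'.isIdempotentElem
    ((hT₁.continuousAt.mul hA₁).mul hG.continuousAt) hD₁ ?_
  filter_upwards [hTG, hA, hD] with z h1 h2 h3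
  rw [← h3, ← h1, h2, ← mul_assoc, ← mul_assoc, eT, mul_assoc (T z)]

section Extension

omit [CompleteSpace H]

variable {W : Submodule ℂ H} {π : H →L[ℂ] W}

/-- The operator on `H` which acts as `F` on `W` and as the identity on the kernel of the
retraction `π : H → W`. -/
def extendByOne (π : H →L[ℂ] W) (F : W →L[ℂ] W) : H →L[ℂ] H :=
  W.subtypeL ∘L F ∘L π + (1 - W.subtypeL ∘L π)

theorem extendByOne_apply (F : W →L[ℂ] W) (x : H) :
    extendByOne π F x = F (π x) + (x - π x) := by
  simp [extendByOne]

variable (hπ : ∀ w : W, π w = w)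
include hπ

theorem retraction_extendByOne (F : W →L[ℂ] W) (x : H) : π (extendByOne π F x) = F (π x) := by
  rw [extendByOne_apply, map_add, map_sub, hπ, hπ, sub_self, add_zero]

theorem extendByOne_mul (F F' : W →L[ℂ] W) :
    extendByOne π (F * F') = extendByOne π F * extendByOne π F' := by
  ext x
  rw [mul_apply_eq_comp, extendByOne_apply F, retraction_extendByOne hπ, extendByOne_apply,
    extendByOne_apply]
  simp

theorem isIdempotentElem_conj {P : W →L[ℂ] W} (hP : IsIdempotentElem P) :
    IsIdempotentElem (W.subtypeL ∘L P ∘L π) := by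
  ext x
  have : P (P (π x)) = P (π x) := congr($hP (π x))
  simp [hπ, this]

omit hπ in
theorem extendByOne_elemFactor (P : W →L[ℂ] W) (w : ℂ) :
    extendByOne π (elemFactor P w) = elemFactor (W.subtypeL ∘L P ∘L π) w := by
  ext x
  simp [extendByOne, elemFactor]
  abel

theorem IsCokernelProj.extendByOne {P F : W →L[ℂ] W} (h : IsCokernelProj P F) :
    IsCokernelProj (W.subtypeL ∘L P ∘L π) (extendByOne π F) := by
  refine ⟨isIdempotentElem_conj hπ h.isIdempotentElem, ?_, fun x => ?_⟩
  · ext x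
    have : P (F (π x)) = 0 := congr($(h.mul_eq_zero) (π x))
    simp [retraction_extendByOne hπ, this]
  · obtain ⟨y, hy⟩ := h.exists_apply_eq (π x)
    refine ⟨y + (x - π x), ?_⟩
    have : π (y + (x - π x)) = y := by simp [hπ]
    rw [extendByOne_apply, this, hy]
    simp

theorem finrank_ker_extendByOne (F : W →L[ℂ] W) :
    Module.finrank ℂ (extendByOne π F).ker = Module.finrank ℂ F.ker := by
  have key : ∀ x ∈ (Howland.extendByOne π F).ker, F (π x) = 0 ∧ (π x : H) = x := by
    intro x hx
    have hx' : Howland.extendByOne π F x = 0 := hx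
    have h1 : F (π x) = 0 := by rw [← retraction_extendByOne hπ, hx', map_zero]
    refine ⟨h1, ?_⟩
    rw [extendByOne_apply, h1] at hx'
    have h2 : x - π x = 0 := by simpa using hx'
    exact (sub_eq_zero.1 h2).symm
  refine LinearEquiv.finrank_eq
    { toFun := fun x => ⟨π x, (key x x.2).1⟩
      invFun := fun w => ⟨(w : W), ?_⟩
      map_add' := fun x y => by ext; simp
      map_smul' := fun c x => by ext; simp
      left_inv := fun x => by ext; exact (key x x.2).2
      right_inv := fun w => by ext; simp [hπ] }
  have hw : F w = 0 := w.2
  change Howland.extendByOne π F _ = 0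
  rw [extendByOne_apply, hπ, hw]
  simp

end Extension

theorem exists_isCokernelProj_of_finiteDimensional {W : Type*} [NormedAddCommGroup W]
    [InnerProductSpace ℂ W] [FiniteDimensional ℂ W] (F : W →L[ℂ] W) :
    ∃ P : W →L[ℂ] W, IsCokernelProj P F ∧ Module.finrank ℂ P.range = Module.finrank ℂ F.ker := by
  obtain ⟨P, hP, hr⟩ := exists_isCokernelProj F
  refine ⟨P, hP, ?_⟩
  have h1 := LinearMap.finrank_range_add_finrank_ker F.toLinearMap
  have h2 := F.range.finrank_add_finrank_orthogonal
  rw [hr]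
  omega

/-- `A` is near `z₀` analytically equivalent to the extension by the identity of an analytic
function `F` with values in the operators on a finite-dimensional subspace `W`. -/
structure IsFiniteBlock (A : ℂ → H →L[ℂ] H) (z₀ : ℂ) (W : Submodule ℂ H) (π : H →L[ℂ] W)
    (F : ℂ → W →L[ℂ] W) : Prop where
  retraction : ∀ w : W, π w = w
  analyticAt : AnalyticAt ℂ F z₀
  equiv : AnalyticEquivAt A (fun z => extendByOne π (F z)) z₀

omit [CompleteSpace H] in
theorem IsFiniteBlock.det_ne_zero {A : ℂ → H →L[ℂ] H} {z₀ : ℂ} {W : Submodule ℂ H}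
    [FiniteDimensional ℂ W] {π : H →L[ℂ] W} {F : ℂ → W →L[ℂ] W} (h : IsFiniteBlock A z₀ W π F)
    (hA : IsUnit (A z₀)) : LinearMap.det (F z₀).toLinearMap ≠ 0 := by
  obtain ⟨T, G, -, -, hT, hG, hTG⟩ := h.equiv
  have h1 : IsUnit (extendByOne π (F z₀)) := by
    have := (hT.mul hA).mul hG
    rwa [hTG.self_of_nhds] at this
  obtain ⟨u, hu⟩ := h1
  have hinj : Function.Injective (extendByOne π (F z₀)) := by
    intro x y hxy
    rw [← hu] at hxy
    have h2 : ∀ x, (↑u⁻¹ : H →L[ℂ] H) ((u : H →L[ℂ] H) x) = x := fun x => congr($(u.inv_mul) x)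
    rw [← h2 x, hxy, h2]
  have hker : (F z₀).toLinearMap.ker = ⊥ := by
    refine LinearMap.ker_eq_bot'.2 fun w hw => ?_
    have hw' : F z₀ w = 0 := hw
    have : extendByOne π (F z₀) w = extendByOne π (F z₀) 0 := by
      simp [extendByOne_apply, h.retraction, hw']
    simpa using hinj this
  exact ((LinearMap.isUnit_iff_isUnit_det _).1
    ((LinearMap.isUnit_iff_ker_eq_bot _).2 hker)).ne_zero

/-- One step of the reduction, on the side of the finite block: the determinant loses a factor
`(z - z₀) ^ d`, up to sign, with `d = dim ker A(z₀)`. -/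
theorem IsFiniteBlock.exists_of_elemFactor_mul {A A₁ : ℂ → H →L[ℂ] H} {z₀ : ℂ}
    {W : Submodule ℂ H} [FiniteDimensional ℂ W] {π : H →L[ℂ] W} {F : ℂ → W →L[ℂ] W}
    (h : IsFiniteBlock A z₀ W π F) {P : H →L[ℂ] H} (hP : IsCokernelProj P (A z₀))
    (hA₁ : ContinuousAt A₁ z₀) (hA : ∀ᶠ z in 𝓝 z₀, A z = elemFactor P (z - z₀) * A₁ z) :
    ∃ F₁ : ℂ → W →L[ℂ] W, IsFiniteBlock A₁ z₀ W π F₁ ∧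
      ∀ z, LinearMap.det (F z).toLinearMap =
        (-(z - z₀)) ^ Module.finrank ℂ (A z₀).ker * LinearMap.det (F₁ z).toLinearMap := by
  obtain ⟨P', hP', hr⟩ := exists_isCokernelProj_of_finiteDimensional (F z₀)
  have hr' : Module.finrank ℂ (A z₀).ker = Module.finrank ℂ P'.range := by
    obtain ⟨T, G, -, -, hT, hG, hTG⟩ := h.equiv
    have h1 : T z₀ * A z₀ * G z₀ = extendByOne π (F z₀) := hTG.self_of_nhds
    rw [hr, ← finrank_ker_extendByOne h.retraction, ← h1, finrank_ker_mul_mul hT hG]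
  let F₁ := divFactor P' z₀ F
  have hF₁ : ∀ z, elemFactor P' (z - z₀) * F₁ z = F z :=
    elemFactor_mul_divFactor hP'.isIdempotentElem hP'.mul_eq_zero
  have hF₁a : AnalyticAt ℂ F₁ z₀ := analyticAt_divFactor _ h.analyticAt
  refine ⟨F₁, ⟨h.retraction, hF₁a, ?_⟩, fun z => ?_⟩
  · refine h.equiv.of_elemFactor_mul hP (hP'.extendByOne h.retraction) hA₁ ?_ hA ?_
    · have := hF₁a.continuousAt
      unfold extendByOne
      fun_prop
    · refine Filter.Eventually.of_forall fun z => ?_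
      rw [← extendByOne_elemFactor, ← extendByOne_mul h.retraction, hF₁]
  · rw [← hF₁ z, hr', ← det_elemFactor hP'.isIdempotentElem]
    exact LinearMap.det_comp _ _

/-! ### The factorization -/

omit [CompleteSpace H] in
theorem isFiniteRank_sub_of_elemFactor_mul {P A B : H →L[ℂ] H} (hP : IsFiniteRank P) {w : ℂ}
    (h : A = elemFactor P w * B) : IsFiniteRank (A - B) := by
  have : A - B = (-P + (-w) • P) * B := by
    rw [h, elemFactor, sub_mul, sub_mul, add_mul, one_mul, neg_mul, neg_smul, neg_mul]
    abel
  rw [this]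
  exact (hP.neg.add (hP.smul _)).mul_right B

/-- The factorization, by induction on the order of the pole of the inverse. The last item says
that the ranks add up to the order of the zero of the determinant of every finite block of `A`. -/
theorem exists_factorization {Ω : Set ℂ} (hΩ : IsOpen Ω) {z₀ : ℂ} (hz₀ : z₀ ∈ Ω) (n : ℕ) :
    ∀ {A : ℂ → H →L[ℂ] H}, AnalyticOnNhd ℂ A Ω → (∀ z ∈ Ω, (A z).IsFredholm) →
      InverseHasPole A z₀ n →
    ∃ (P : Fin n → H →L[ℂ] H) (B : ℂ → H →L[ℂ] H),
      (∀ j, IsIdempotentElem (P j)) ∧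
      (∀ j, FiniteDimensional ℂ (P j).range) ∧
      (∀ j, 1 ≤ Module.finrank ℂ (P j).range) ∧
      (Antitone fun j => Module.finrank ℂ (P j).range) ∧
      (∀ z, A z = (List.ofFn fun j => elemFactor (P j) (z - z₀)).prod * B z) ∧
      AnalyticOnNhd ℂ B Ω ∧
      (∀ z ∈ Ω, (B z).IsFredholm) ∧
      IsUnit (B z₀) ∧
      (∀ j, Module.finrank ℂ (P j).range ≤ Module.finrank ℂ (A z₀).ker) ∧
      (∀ h : 0 < n, Module.finrank ℂ (P ⟨0, h⟩).range = Module.finrank ℂ (A z₀).ker) ∧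
      (∀ z, IsFiniteRank (A z - B z)) ∧
      (∀ (W : Submodule ℂ H) [FiniteDimensional ℂ W] (π : H →L[ℂ] W) (F : ℂ → W →L[ℂ] W),
        IsFiniteBlock A z₀ W π F →
        meromorphicOrderAt (fun z => LinearMap.det (F z).toLinearMap) z₀ =
          ((∑ j, Module.finrank ℂ (P j).range : ℕ) : WithTop ℤ)) := by
  induction n with
  | zero =>
    intro A hA hF hpole
    have hu : IsUnit (A z₀) := hpole.isUnit_of_zero (hA z₀ hz₀).continuousAt
    refine ⟨Fin.elim0, A, fun j => j.elim0, fun j => j.elim0, fun j => j.elim0, fun j => j.elim0,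
      fun z => by simp, hA, hF, hu, fun j => j.elim0, fun h => absurd h (lt_irrefl _),
      fun z => ?_, fun W _ π F hW => ?_⟩
    · rw [sub_self, isFiniteRank_iff_hasFiniteRange]
      exact LinearMap.HasFiniteRange.zero
    · have h1 := analyticAt_det hW.analyticAt
      rw [h1.meromorphicOrderAt_eq, (h1.analyticOrderAt_eq_zero).2 (hW.det_ne_zero hu)]
      simp
  | succ n ih =>
    intro A hA hF hpole
    have hAc : ContinuousAt A z₀ := (hA z₀ hz₀).continuousAt
    have hclosure : A z₀ ∈ closure {S : H →L[ℂ] H | IsUnit S} :=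
      mem_closure_of_tendsto (hAc.mono_left nhdsWithin_le_nhds) hpole.1
    have hker := finrank_ker_eq_of_mem_closure_isUnit (hF z₀ hz₀) hclosure
    have : CompleteSpace (A z₀).range := (hF z₀ hz₀).isClosed_range.completeSpace_coe
    obtain ⟨P, hP, hPr⟩ := exists_isCokernelProj (A z₀)
    let A₁ := divFactor P z₀ A
    have hAA₁ : ∀ z, elemFactor P (z - z₀) * A₁ z = A z :=
      elemFactor_mul_divFactor hP.isIdempotentElem hP.mul_eq_zero
    have hA₁ : AnalyticOnNhd ℂ A₁ Ω := analyticOnNhd_divFactor P hΩ hz₀ hA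
    obtain ⟨hP0, hpole₁⟩ := hpole.of_elemFactor_mul hAc hP (.of_forall fun z => (hAA₁ z).symm)
    have hPrk : Module.finrank ℂ P.range = Module.finrank ℂ (A z₀).ker := by rw [hPr, hker]
    have hPfin : IsFiniteRank P := by
      have h1 : (A z₀).range.CoFG := (hF z₀ hz₀).finite_coker
      rw [isFiniteRank_iff_hasFiniteRange, LinearMap.HasFiniteRange, hPr]
      exact h1.fg_of_isCompl (Submodule.isCompl_orthogonal _)
    have hsub : ∀ z, IsFiniteRank (A z - A₁ z) := fun z =>
      isFiniteRank_sub_of_elemFactor_mul hPfin (hAA₁ z).symm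
    have hkerle : Module.finrank ℂ (A₁ z₀).ker ≤ Module.finrank ℂ (A z₀).ker := by
      have := (hF z₀ hz₀).finite_ker
      refine Submodule.finrank_mono fun x hx => ?_
      have hx' : A₁ z₀ x = 0 := hx
      change A z₀ x = 0
      rw [← hAA₁, mul_apply_eq_comp, hx', map_zero]
    obtain ⟨Ps, B, h1, h2, h3, h4, h5, h6, h7, h8, h9, -, h11, h12⟩ :=
      ih hA₁ (fun z hz => isFredholm_of_isFiniteRank_sub (hF z hz) (hsub z)) hpole₁
    have hPone : 1 ≤ Module.finrank ℂ P.range := by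
      have : FiniteDimensional ℂ P.range := hPfin
      refine Submodule.one_le_finrank_iff.2 fun h => hP0 ?_
      ext x
      exact congr($(LinearMap.range_eq_bot.1 h) x)
    have hanti : Antitone fun j => Module.finrank ℂ
        ((Fin.cons P Ps : Fin (n + 1) → H →L[ℂ] H) j).range := by
      intro i j
      induction i using Fin.cases with
      | zero =>
        induction j using Fin.cases with
        | zero => exact fun _ => le_rfl
        | succ j => exact fun _ => ((h9 j).trans hkerle).trans hPrk.ge
      | succ i =>
        induction j using Fin.cases with
        | zero => exact fun h => absurd h (not_le.2 (Fin.succ_pos i))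
        | succ j => exact fun h => h4 (Fin.succ_le_succ_iff.1 h)
    refine ⟨Fin.cons P Ps, B, Fin.forall_fin_succ.2 ⟨hP.isIdempotentElem, h1⟩,
      Fin.forall_fin_succ.2 ⟨hPfin, h2⟩, Fin.forall_fin_succ.2 ⟨hPone, h3⟩, hanti, fun z => ?_,
      h6, h7, h8, Fin.forall_fin_succ.2 ⟨hPrk.le, fun j => (h9 j).trans hkerle⟩,
      fun _ => hPrk, fun z => ?_, fun W _ π F hW => ?_⟩
    · rw [List.ofFn_succ, List.prod_cons, mul_assoc]
      simp only [Fin.cons_zero, Fin.cons_succ]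
      rw [← h5, hAA₁]
    · have := (hsub z).add (h11 z)
      rwa [sub_add_sub_cancel] at this
    · obtain ⟨F₁, hW₁, hdet⟩ := hW.exists_of_elemFactor_mul hP (hA₁ z₀ hz₀).continuousAt
        (.of_forall fun z => (hAA₁ z).symm)
      have e1 := h12 W π F₁ hW₁
      have e2 : meromorphicOrderAt (fun z => (-(z - z₀)) ^ Module.finrank ℂ (A z₀).ker) z₀ =
          ((Module.finrank ℂ (A z₀).ker : ℤ) : WithTop ℤ) := by
        refine (meromorphicOrderAt_eq_int_iff (by fun_prop)).2
          ⟨fun _ => (-1) ^ Module.finrank ℂ (A z₀).ker, analyticAt_const, by simp,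
            .of_forall fun z => ?_⟩
        rw [zpow_natCast, smul_eq_mul, ← mul_pow]
        ring
      rw [funext hdet, fun_meromorphicOrderAt_mul (by fun_prop)
        (analyticAt_det hW₁.analyticAt).meromorphicAt, e1, e2, Fin.sum_univ_succ]
      change _ = ((Module.finrank ℂ P.range + ∑ j, Module.finrank ℂ (Ps j).range : ℕ) : WithTop ℤ)
      rw [hPrk]
      rfl

/-! ### Riesz idempotents in Banach algebras -/

section BanachAlgebra

open Metric

theorem circleIntegral_clm_comp {E F : Type*} [NormedAddCommGroup E] [NormedSpace ℂ E]
    [CompleteSpace E] [NormedAddCommGroup F] [NormedSpace ℂ F] [CompleteSpace F] (L : E →L[ℂ] F)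
    {f : ℂ → E} {c : ℂ} {R : ℝ} (hf : CircleIntegrable f c R) :
    (∮ z in C(c, R), L (f z)) = L (∮ z in C(c, R), f z) := by
  unfold circleIntegral
  rw [← L.intervalIntegral_comp_comm hf.out]
  simp

/-- Fubini's theorem for two circle integrals of a continuous function. -/
theorem circleIntegral_swap {E : Type*} [NormedAddCommGroup E] [NormedSpace ℂ E]
    {f : ℂ → ℂ → E} {r R : ℝ} (hr : 0 ≤ r) (hR : 0 ≤ R)
    (hf : ContinuousOn (Function.uncurry f) (sphere 0 r ×ˢ sphere 0 R)) :
    (∮ z in C(0, r), ∮ w in C(0, R), f z w) = ∮ w in C(0, R), ∮ z in C(0, r), f z w := by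
  have hc : Continuous fun p : ℝ × ℝ => f (circleMap 0 r p.1) (circleMap 0 R p.2) :=
    hf.comp_continuous (f := fun p : ℝ × ℝ => (circleMap 0 r p.1, circleMap 0 R p.2))
      (by fun_prop) fun p => ⟨circleMap_mem_sphere _ hr _, circleMap_mem_sphere _ hR _⟩
  have hint : MeasureTheory.Integrable
      (Function.uncurry fun s t : ℝ => deriv (circleMap 0 r) s • deriv (circleMap 0 R) t •
        f (circleMap 0 r s) (circleMap 0 R t))
      ((MeasureTheory.volume.restrict (Set.Ioc 0 (2 * Real.pi))).prod
        (MeasureTheory.volume.restrict (Set.Ioc 0 (2 * Real.pi)))) := by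
    rw [MeasureTheory.Measure.prod_restrict]
    have hcont : Continuous (Function.uncurry fun s t : ℝ => deriv (circleMap 0 r) s •
        deriv (circleMap 0 R) t • f (circleMap 0 r s) (circleMap 0 R t)) := by
      simp only [deriv_circleMap, Function.uncurry_def]
      exact Continuous.smul (by fun_prop) (Continuous.smul (by fun_prop) hc)
    have hK : IsCompact (Set.Icc (0 : ℝ) (2 * Real.pi) ×ˢ Set.Icc (0 : ℝ) (2 * Real.pi)) :=
      isCompact_Icc.prod isCompact_Icc
    exact (hcont.continuousOn.integrableOn_compact hK).mono_set
      (Set.prod_mono Set.Ioc_subset_Icc_self Set.Ioc_subset_Icc_self)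
  have h := MeasureTheory.integral_integral_swap hint
  unfold circleIntegral
  simp only [intervalIntegral.integral_of_le Real.two_pi_pos.le, ← MeasureTheory.integral_smul]
  rw [h]
  simp only [smul_comm (deriv (circleMap 0 r) _)]

variable {𝔸 : Type*} [NormedRing 𝔸] [NormedAlgebra ℂ 𝔸] [CompleteSpace 𝔸]

/-- The Riesz idempotent `-(2πi)⁻¹ ∮ (a - ζ)⁻¹ dζ` of an element `a` of a Banach algebra, over
the circle of radius `r` around `0`. -/
def rieszIdem (a : 𝔸) (r : ℝ) : 𝔸 :=
  (-(2 * (Real.pi : ℂ) * Complex.I)⁻¹) • ∮ ζ in C(0, r), Ring.inverse (a - ζ • (1 : 𝔸))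

theorem differentiableAt_resolvent {a : 𝔸} {ζ : ℂ} (h : IsUnit (a - ζ • (1 : 𝔸))) :
    DifferentiableAt ℂ (fun ζ : ℂ => Ring.inverse (a - ζ • (1 : 𝔸))) ζ := by
  exact DifferentiableAt.inverse (by fun_prop) h

theorem continuousOn_resolvent {a : 𝔸} {s : Set ℂ} (h : ∀ ζ ∈ s, IsUnit (a - ζ • (1 : 𝔸))) :
    ContinuousOn (fun ζ : ℂ => Ring.inverse (a - ζ • (1 : 𝔸))) s := fun ζ hζ =>
  (differentiableAt_resolvent (h ζ hζ)).continuousAt.continuousWithinAt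

theorem circleIntegrable_resolvent {a : 𝔸} {r : ℝ} (hr : 0 < r)
    (h : ∀ ζ ∈ sphere (0 : ℂ) r, IsUnit (a - ζ • (1 : 𝔸))) :
    CircleIntegrable (fun ζ : ℂ => Ring.inverse (a - ζ • (1 : 𝔸))) 0 r :=
  (continuousOn_resolvent h).circleIntegrable hr.le

omit [NormedAlgebra ℂ 𝔸] [CompleteSpace 𝔸] in
theorem commute_ringInverse {a b : 𝔸} (hb : IsUnit b) (h : Commute a b) :
    Commute a (Ring.inverse b) := by
  obtain ⟨u, rfl⟩ := hb
  rw [Ring.inverse_unit]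
  exact h.units_inv_right

theorem commute_rieszIdem {a : 𝔸} {r : ℝ} (hr : 0 < r)
    (h : ∀ ζ ∈ sphere (0 : ℂ) r, IsUnit (a - ζ • (1 : 𝔸))) : Commute a (rieszIdem a r) := by
  refine Commute.smul_right ?_ _
  have hint := circleIntegrable_resolvent hr h
  have h1 := circleIntegral_clm_comp (ContinuousLinearMap.mul ℂ 𝔸 a) hint
  have h2 := circleIntegral_clm_comp ((ContinuousLinearMap.mul ℂ 𝔸).flip a) hint
  simp only [ContinuousLinearMap.mul_apply', ContinuousLinearMap.flip_apply] at h1 h2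
  rw [Commute, SemiconjBy, ← h1, ← h2]
  refine circleIntegral.integral_congr hr.le fun ζ hζ => ?_
  refine commute_ringInverse (h ζ hζ) ?_
  exact (Commute.refl a).sub_right ((Commute.one_right a).smul_right ζ)

/-- The circle of integration can be shrunk within the resolvent set. -/
theorem rieszIdem_eq_of_le {a : 𝔸} {r R : ℝ} (hr : 0 < r) (hrR : r ≤ R)
    (h : ∀ ζ : ℂ, r ≤ ‖ζ‖ → ‖ζ‖ ≤ R → IsUnit (a - ζ • (1 : 𝔸))) :
    rieszIdem a R = rieszIdem a r := by
  unfold rieszIdem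
  congr 1
  refine Complex.circleIntegral_eq_of_differentiable_on_annulus_off_countable hr hrR
    Set.countable_empty ?_ ?_
  · refine continuousOn_resolvent fun ζ hζ => h ζ ?_ ?_
    · simpa using hζ.2
    · simpa using hζ.1
  · intro ζ hζ
    refine differentiableAt_resolvent (h ζ ?_ ?_)
    · have : r < ‖ζ‖ := by simpa using hζ.1.2
      exact this.le
    · have : ‖ζ‖ < R := by simpa using hζ.1.1
      exact this.le

omit [CompleteSpace 𝔸] in
theorem resolvent_mul_resolvent {a : 𝔸} {ζ w : ℂ} (hne : ζ ≠ w)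
    (hζ : IsUnit (a - ζ • (1 : 𝔸))) (hw : IsUnit (a - w • (1 : 𝔸))) :
    Ring.inverse (a - ζ • (1 : 𝔸)) * Ring.inverse (a - w • (1 : 𝔸)) =
      (ζ - w)⁻¹ • Ring.inverse (a - ζ • (1 : 𝔸)) - (ζ - w)⁻¹ • Ring.inverse (a - w • (1 : 𝔸)) := by
  obtain ⟨u, hu⟩ := hζ
  obtain ⟨v, hv⟩ := hw
  have e : (v : 𝔸) - u = (ζ - w) • (1 : 𝔸) := by rw [hu, hv, sub_smul]; abel
  rw [← hu, ← hv, Ring.inverse_unit, Ring.inverse_unit, ← smul_sub,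
    eq_inv_smul_iff₀ (sub_ne_zero.2 hne)]
  have : ((↑u⁻¹ : 𝔸) * ((v : 𝔸) - u)) * ↑v⁻¹ = ↑u⁻¹ - ↑v⁻¹ := by
    rw [mul_sub, sub_mul, Units.inv_mul, one_mul, mul_assoc, Units.mul_inv, mul_one]
  rw [← this, e, mul_smul_comm, mul_one, smul_mul_assoc]

/-- The product of the Riesz idempotents for two concentric circles is the inner one: insert the
resolvent identity and exchange the integrals. -/
theorem rieszIdem_mul_rieszIdem {a : 𝔸} {r R : ℝ} (hr : 0 < r) (hrR : r < R)
    (h1 : ∀ ζ ∈ sphere (0 : ℂ) r, IsUnit (a - ζ • (1 : 𝔸)))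
    (h2 : ∀ ζ ∈ sphere (0 : ℂ) R, IsUnit (a - ζ • (1 : 𝔸))) :
    rieszIdem a r * rieszIdem a R = rieszIdem a r := by
  have hR : 0 < R := hr.trans hrR
  set ρ : ℂ → 𝔸 := fun ζ => Ring.inverse (a - ζ • (1 : 𝔸)) with hρ
  have hc1 : ContinuousOn ρ (sphere 0 r) := continuousOn_resolvent h1
  have hc2 : ContinuousOn ρ (sphere 0 R) := continuousOn_resolvent h2
  have hi1 : CircleIntegrable ρ 0 r := circleIntegrable_resolvent hr h1
  have hi2 : CircleIntegrable ρ 0 R := circleIntegrable_resolvent hR h2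
  have hne : ∀ ζ ∈ sphere (0 : ℂ) r, ∀ w ∈ sphere (0 : ℂ) R, ζ ≠ w := by
    rintro ζ hζ w hw rfl
    rw [mem_sphere] at hζ hw
    linarith
  have hcinv : ContinuousOn (fun p : ℂ × ℂ => (p.1 - p.2)⁻¹) (sphere 0 r ×ˢ sphere 0 R) :=
    ContinuousOn.inv₀ (by fun_prop) fun p hp => sub_ne_zero.2 (hne _ hp.1 _ hp.2)
  have hc22 : ContinuousOn (fun p : ℂ × ℂ => ρ p.2) (sphere 0 r ×ˢ sphere 0 R) :=
    hc2.comp continuousOn_snd fun p hp => hp.2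
  -- the inner integrals of the two terms of the resolvent identity
  have k1 : ∀ ζ ∈ sphere (0 : ℂ) r,
      (∮ w in C(0, R), (ζ - w)⁻¹ • ρ ζ) = (-(2 * Real.pi * Complex.I : ℂ)) • ρ ζ := by
    intro ζ hζ
    rw [circleIntegral.integral_smul_const]
    congr 1
    have : ζ ∈ ball (0 : ℂ) R := by
      rw [mem_sphere] at hζ; rw [mem_ball]; linarith
    rw [← circleIntegral.integral_sub_inv_of_mem_ball this]
    unfold circleIntegral
    rw [← intervalIntegral.integral_neg]
    congr 1
    ext θ
    rw [← smul_neg, ← inv_neg, neg_sub]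
  have k2 : ∀ w ∈ sphere (0 : ℂ) R, (∮ ζ in C(0, r), (ζ - w)⁻¹ • ρ w) = 0 := by
    intro w hw
    have hnw : ∀ ζ ∈ closedBall (0 : ℂ) r, ζ - w ≠ 0 := by
      intro ζ hζ h0
      rw [sub_eq_zero] at h0
      subst h0
      rw [mem_sphere] at hw
      rw [mem_closedBall] at hζ
      linarith
    rw [circleIntegral.integral_smul_const]
    rw [Complex.circleIntegral_eq_zero_of_differentiable_on_off_countable hr.le
      Set.countable_empty, zero_smul]
    · exact ContinuousOn.inv₀ (by fun_prop) hnw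
    · intro ζ hζ
      exact DifferentiableAt.inv (by fun_prop) (hnw ζ (ball_subset_closedBall hζ.1))
  have k3 : ∀ ζ ∈ sphere (0 : ℂ) r, (∮ w in C(0, R), (ζ - w)⁻¹ • ρ w) =
      (-(2 * Real.pi * Complex.I : ℂ)) • ρ ζ - ρ ζ * ∮ w in C(0, R), ρ w := by
    intro ζ hζ
    have hci : ContinuousOn (fun w => (ζ - w)⁻¹) (sphere 0 R) :=
      ContinuousOn.inv₀ (by fun_prop) fun w hw => sub_ne_zero.2 (hne ζ hζ w hw)
    have e1 : ρ ζ * (∮ w in C(0, R), ρ w) = ∮ w in C(0, R), ρ ζ * ρ w :=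
      (circleIntegral_clm_comp (ContinuousLinearMap.mul ℂ 𝔸 (ρ ζ)) hi2).symm
    have e2 : (∮ w in C(0, R), ρ ζ * ρ w) =
        (∮ w in C(0, R), (ζ - w)⁻¹ • ρ ζ) - ∮ w in C(0, R), (ζ - w)⁻¹ • ρ w := by
      rw [← circleIntegral.integral_sub]
      · exact circleIntegral.integral_congr hR.le fun w hw =>
          resolvent_mul_resolvent (hne ζ hζ w hw) (h1 ζ hζ) (h2 w hw)
      · exact (hci.smul continuousOn_const).circleIntegrable hR.le
      · exact (hci.smul hc2).circleIntegrable hR.le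
    rw [e1, e2, k1 ζ hζ, sub_sub_cancel]
  have hprod : (∮ ζ in C(0, r), ρ ζ) * (∮ w in C(0, R), ρ w) =
      (-(2 * Real.pi * Complex.I : ℂ)) • ∮ ζ in C(0, r), ρ ζ := by
    have e0 : (∮ ζ in C(0, r), ∮ w in C(0, R), (ζ - w)⁻¹ • ρ w) = 0 := by
      rw [circleIntegral_swap (f := fun ζ w => (ζ - w)⁻¹ • ρ w) hr.le hR.le (hcinv.smul hc22),
        circleIntegral.integral_congr hR.le k2]
      simp [circleIntegral]
    have e1 : (∮ ζ in C(0, r), ρ ζ * ∮ w in C(0, R), ρ w) =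
        (∮ ζ in C(0, r), ρ ζ) * ∮ w in C(0, R), ρ w :=
      circleIntegral_clm_comp ((ContinuousLinearMap.mul ℂ 𝔸).flip (∮ w in C(0, R), ρ w)) hi1
    rw [circleIntegral.integral_congr hr.le k3, circleIntegral.integral_sub
      (ContinuousOn.circleIntegrable hr.le (by fun_prop))
      (ContinuousOn.circleIntegrable hr.le (by fun_prop)), circleIntegral.integral_smul, e1,
      sub_eq_zero] at e0
    exact e0.symm
  have hpi : (2 * Real.pi * Complex.I : ℂ) ≠ 0 := Complex.two_pi_I_ne_zero
  simp only [rieszIdem]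
  rw [smul_mul_smul_comm, hprod, smul_smul]
  congr 1
  field_simp

/-- The set of `ζ` with `a - ζ` invertible is open, so the circle can be replaced by a slightly
smaller one in one of two factors. -/
theorem isIdempotentElem_rieszIdem {a : 𝔸} {R : ℝ} (hR : 0 < R)
    (h : ∀ ζ ∈ sphere (0 : ℂ) R, IsUnit (a - ζ • (1 : 𝔸))) : IsIdempotentElem (rieszIdem a R) := by
  have hopen : IsOpen {ζ : ℂ | IsUnit (a - ζ • (1 : 𝔸))} :=
    Units.isOpen.preimage (f := fun ζ : ℂ => a - ζ • (1 : 𝔸)) (by fun_prop)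
  obtain ⟨δ, hδ, hsub⟩ := (isCompact_sphere (0 : ℂ) R).exists_thickening_subset_open hopen h
  set r := R - min δ R / 2 with hr
  have hm : 0 < min δ R := lt_min hδ hR
  have hr0 : 0 < r := by have := min_le_right δ R; linarith
  have hrR : r < R := by linarith
  have hu : ∀ ζ : ℂ, r ≤ ‖ζ‖ → ‖ζ‖ ≤ R → IsUnit (a - ζ • (1 : 𝔸)) := by
    intro ζ h1 h2
    refine hsub (mem_thickening_iff.2 ⟨((R / ‖ζ‖ : ℝ) : ℂ) * ζ, ?_, ?_⟩)
    · have : ‖ζ‖ ≠ 0 := by linarith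
      rw [mem_sphere_zero_iff_norm, norm_mul, Complex.norm_real,
        Real.norm_of_nonneg (by positivity)]
      field_simp
    · have h0 : 0 < ‖ζ‖ := by linarith
      have e : ζ - ((R / ‖ζ‖ : ℝ) : ℂ) * ζ = ((1 - R / ‖ζ‖ : ℝ) : ℂ) * ζ := by push_cast; ring
      rw [dist_eq_norm, e, norm_mul, Complex.norm_real, Real.norm_eq_abs, abs_sub_comm,
        abs_of_nonneg (sub_nonneg.2 ((one_le_div h0).2 h2)), sub_mul,
        div_mul_cancel₀ _ h0.ne', one_mul]
      have := min_le_left δ R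
      linarith
  have h1 : ∀ ζ ∈ sphere (0 : ℂ) r, IsUnit (a - ζ • (1 : 𝔸)) := fun ζ hζ => by
    rw [mem_sphere_zero_iff_norm] at hζ
    exact hu ζ hζ.ge (hζ.le.trans hrR.le)
  have h2 := rieszIdem_mul_rieszIdem hr0 hrR h1 h
  rwa [← rieszIdem_eq_of_le hr0 hrR.le hu] at h2

/-- The element `a` is invertible on the complement of its Riesz idempotent `p`; the inverse there
is `(2πi)⁻¹ ∮ ζ⁻¹ (a - ζ)⁻¹ dζ`. -/
theorem isUnit_rieszIdem_add {a : 𝔸} {r : ℝ} (hr : 0 < r)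
    (h : ∀ ζ ∈ sphere (0 : ℂ) r, IsUnit (a - ζ • (1 : 𝔸))) :
    IsUnit (rieszIdem a r + (1 - rieszIdem a r) * a) := by
  set p := rieszIdem a r with hp
  have hpp : IsIdempotentElem p := isIdempotentElem_rieszIdem hr h
  have hpp' : p * p = p := hpp
  have hap : a * p = p * a := commute_rieszIdem hr h
  set ρ : ℂ → 𝔸 := fun ζ => Ring.inverse (a - ζ • (1 : 𝔸)) with hρ
  have hc : ContinuousOn ρ (sphere 0 r) := continuousOn_resolvent h
  have h0 : ∀ ζ ∈ sphere (0 : ℂ) r, ζ ≠ 0 := by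
    rintro ζ hζ rfl
    rw [mem_sphere_zero_iff_norm, norm_zero] at hζ
    exact hr.ne hζ
  have hcinv : ContinuousOn (fun ζ : ℂ => ζ⁻¹) (sphere 0 r) := continuousOn_id.inv₀ h0
  have hi : CircleIntegrable (fun ζ => ζ⁻¹ • ρ ζ) 0 r := (hcinv.smul hc).circleIntegrable hr.le
  have hpi : (2 * Real.pi * Complex.I : ℂ) ≠ 0 := Complex.two_pi_I_ne_zero
  have hsum : (∮ ζ in C(0, r), (ζ⁻¹ • (1 : 𝔸) + ρ ζ)) =
      (2 * Real.pi * Complex.I : ℂ) • (1 - p) := by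
    have hi' : CircleIntegrable (fun ζ => ζ⁻¹ • (1 : 𝔸)) 0 r :=
      (hcinv.smul continuousOn_const).circleIntegrable hr.le
    rw [circleIntegral.integral_add hi' (hc.circleIntegrable hr.le),
      circleIntegral.integral_smul_const]
    have := circleIntegral.integral_sub_center_inv (0 : ℂ) hr.ne'
    simp only [sub_zero] at this
    rw [this, hp, rieszIdem, neg_smul, sub_neg_eq_add, smul_add, smul_smul, mul_inv_cancel₀ hpi,
      one_smul]
  let N := (2 * Real.pi * Complex.I : ℂ)⁻¹ • ∮ ζ in C(0, r), ζ⁻¹ • ρ ζ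
  have hρ1 : ∀ ζ ∈ sphere (0 : ℂ) r, a * (ζ⁻¹ • ρ ζ) = ζ⁻¹ • (1 : 𝔸) + ρ ζ := by
    intro ζ hζ
    have e : a * ρ ζ = 1 + ζ • ρ ζ := by
      have := Ring.mul_inverse_cancel _ (h ζ hζ)
      rw [sub_mul, smul_mul_assoc, one_mul, sub_eq_iff_eq_add] at this
      exact this
    rw [mul_smul_comm, e, smul_add, smul_smul, inv_mul_cancel₀ (h0 ζ hζ), one_smul]
  have hρ2 : ∀ ζ ∈ sphere (0 : ℂ) r, (ζ⁻¹ • ρ ζ) * a = ζ⁻¹ • (1 : 𝔸) + ρ ζ := by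
    intro ζ hζ
    have e : ρ ζ * a = 1 + ζ • ρ ζ := by
      have := Ring.inverse_mul_cancel _ (h ζ hζ)
      rw [mul_sub, mul_smul_comm, mul_one, sub_eq_iff_eq_add] at this
      exact this
    rw [smul_mul_assoc, e, smul_add, smul_smul, inv_mul_cancel₀ (h0 ζ hζ), one_smul]
  have haN : a * N = 1 - p := by
    have e := circleIntegral_clm_comp (ContinuousLinearMap.mul ℂ 𝔸 a) hi
    simp only [ContinuousLinearMap.mul_apply'] at e
    rw [mul_smul_comm, ← e, circleIntegral.integral_congr hr.le hρ1, hsum, smul_smul,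
      inv_mul_cancel₀ hpi, one_smul]
  have hNa : N * a = 1 - p := by
    have e := circleIntegral_clm_comp ((ContinuousLinearMap.mul ℂ 𝔸).flip a) hi
    simp only [ContinuousLinearMap.mul_apply', ContinuousLinearMap.flip_apply] at e
    rw [smul_mul_assoc, ← e, circleIntegral.integral_congr hr.le hρ2, hsum, smul_smul,
      inv_mul_cancel₀ hpi, one_smul]
  have hqN : N * (1 - p) = (1 - p) * N := by rw [← haN, ← mul_assoc, hNa, haN]
  have hq : (1 - p) * (1 - p) = 1 - p := hpp.one_sub
  have hpq : p * (1 - p) = 0 := hpp.mul_one_sub_self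
  have hqp : (1 - p) * p = 0 := hpp.one_sub_mul_self
  have haq : a * (1 - p) = (1 - p) * a := by rw [mul_sub, sub_mul, hap, mul_one, one_mul]
  refine ⟨⟨_, p + (1 - p) * N, ?_, ?_⟩, rfl⟩
  · have e1 : (1 - p) * a * p = 0 := by rw [mul_assoc, hap, ← mul_assoc, hqp, zero_mul]
    have e2 : (1 - p) * a * ((1 - p) * N) = 1 - p := by
      rw [mul_assoc, ← mul_assoc a, haq, mul_assoc, haN, hq, hq]
    have e3 : p * ((1 - p) * N) = 0 := by rw [← mul_assoc, hpq, zero_mul]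
    rw [add_mul, mul_add, mul_add, hpp', e1, e2, e3]
    abel
  · have e1 : (1 - p) * N * p = 0 := by rw [← hqN, mul_assoc, hqp, mul_zero]
    have e2 : (1 - p) * N * ((1 - p) * a) = 1 - p := by
      rw [mul_assoc, ← mul_assoc N, hqN, mul_assoc, hNa, hq, hq]
    have e3 : p * ((1 - p) * a) = 0 := by rw [← mul_assoc, hpq, zero_mul]
    rw [add_mul, mul_add, mul_add, hpp', e1, e2, e3]
    abel

/-- The Riesz idempotent depends analytically on the element. The integrand is the inverse of an
element of the Banach algebra of continuous functions on the circle, and inversion in this algebra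
is analytic. -/
theorem analyticAt_rieszIdem {A : ℂ → 𝔸} {z₀ : ℂ} (hA : AnalyticAt ℂ A z₀) {r : ℝ} (hr : 0 < r)
    (h : ∀ ζ ∈ sphere (0 : ℂ) r, IsUnit (A z₀ - ζ • (1 : 𝔸))) :
    AnalyticAt ℂ (fun z => rieszIdem (A z) r) z₀ ∧
      ∀ᶠ z in 𝓝 z₀, ∀ ζ ∈ sphere (0 : ℂ) r, IsUnit (A z - ζ • (1 : 𝔸)) := by
  let J : C(sphere (0 : ℂ) r, 𝔸) := ⟨fun ζ => (ζ : ℂ) • (1 : 𝔸), by fun_prop⟩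
  let 𝓐 : ℂ → C(sphere (0 : ℂ) r, 𝔸) := fun z => ContinuousLinearMap.const ℂ _ (A z) - J
  have h𝓐 : AnalyticAt ℂ 𝓐 z₀ := by
    refine AnalyticAt.sub ?_ analyticAt_const
    exact ((ContinuousLinearMap.const ℂ (sphere (0 : ℂ) r)).analyticAt _).comp hA
  have hval : ∀ z ζ, 𝓐 z ζ = A z - (ζ : ℂ) • (1 : 𝔸) := fun z ζ => rfl
  have hu : ∀ z, IsUnit (𝓐 z) ↔ ∀ ζ ∈ sphere (0 : ℂ) r, IsUnit (A z - ζ • (1 : 𝔸)) := by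
    intro z
    rw [ContinuousMap.isUnit_iff_forall_isUnit]
    exact ⟨fun H ζ hζ => H ⟨ζ, hζ⟩, fun H ζ => H ζ ζ.2⟩
  have hev : ∀ᶠ z in 𝓝 z₀, IsUnit (𝓐 z) :=
    h𝓐.continuousAt (Units.isOpen.mem_nhds ((hu z₀).2 h))
  let pt : ℝ → sphere (0 : ℂ) r := fun θ => ⟨circleMap 0 r θ, circleMap_mem_sphere _ hr.le _⟩
  have hpt : Continuous pt := (continuous_circleMap 0 r).subtype_mk _
  let I₀ : C(sphere (0 : ℂ) r, 𝔸) →ₗ[ℂ] 𝔸 :=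
    { toFun := fun f => ∫ θ in 0..2 * Real.pi, deriv (circleMap 0 r) θ • f (pt θ)
      map_add' := fun f g => by
        rw [← intervalIntegral.integral_add]
        · simp
        all_goals
          refine Continuous.intervalIntegrable ?_ _ _
          simp only [deriv_circleMap]
          fun_prop
      map_smul' := fun c f => by
        rw [RingHom.id_apply, ← intervalIntegral.integral_smul]
        congr 1
        ext θ
        rw [ContinuousMap.smul_apply, smul_comm] }
  let I : C(sphere (0 : ℂ) r, 𝔸) →L[ℂ] 𝔸 := I₀.mkContinuous (r * |2 * Real.pi - 0|) fun f => by
    have : ‖I₀ f‖ ≤ (r * ‖f‖) * |2 * Real.pi - 0| := by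
      refine intervalIntegral.norm_integral_le_of_norm_le_const fun θ _ => ?_
      rw [norm_smul, deriv_circleMap, norm_mul, Complex.norm_I, mul_one, norm_circleMap_zero,
        abs_of_pos hr]
      exact mul_le_mul_of_nonneg_left (f.norm_coe_le_norm _) hr.le
    linarith
  have hI : AnalyticAt ℂ (fun z => I (Ring.inverse (𝓐 z))) z₀ := by
    obtain ⟨u, hu⟩ := (hu z₀).2 h
    have h1 : AnalyticAt ℂ Ring.inverse (𝓐 z₀) := hu ▸ analyticAt_inverse (𝕜 := ℂ) u
    exact (I.analyticAt _).comp (h1.comp h𝓐)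
  refine ⟨?_, hev.mono fun z hz => (hu z).1 hz⟩
  refine AnalyticAt.congr (hI.const_smul (c := -(2 * (Real.pi : ℂ) * Complex.I)⁻¹)) ?_
  filter_upwards [hev] with z hz
  have hinv : ∀ ζ, (Ring.inverse (𝓐 z)) ζ = Ring.inverse (A z - (ζ : ℂ) • (1 : 𝔸)) := by
    intro ζ
    obtain ⟨u, hu⟩ := hz
    have e1 : (u : C(sphere (0 : ℂ) r, 𝔸)) ζ * (↑u⁻¹ : C(sphere (0 : ℂ) r, 𝔸)) ζ = 1 :=
      congr($(u.mul_inv) ζ)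
    have e2 : (↑u⁻¹ : C(sphere (0 : ℂ) r, 𝔸)) ζ * (u : C(sphere (0 : ℂ) r, 𝔸)) ζ = 1 :=
      congr($(u.inv_mul) ζ)
    rw [← hval, ← hu, Ring.inverse_unit]
    exact (Ring.inverse_unit (⟨_, _, e1, e2⟩ : 𝔸ˣ)).symm
  change (-(2 * (Real.pi : ℂ) * Complex.I)⁻¹) • (∫ θ in 0..2 * Real.pi,
    deriv (circleMap 0 r) θ • (Ring.inverse (𝓐 z)) (pt θ)) = _
  simp only [hinv]
  rfl

end BanachAlgebra

/-! ### The block of the Riesz projection -/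

/-- A compact projection acts as the identity on its range, which is therefore locally compact. -/
theorem isFiniteRank_of_isCompactOperator {P : H →L[ℂ] H} (hP : IsIdempotentElem P)
    (hc : IsCompactOperator P) : IsFiniteRank P := by
  have hPP : ∀ x, P (P x) = P x := fun x => congr($hP x)
  have hclosed : IsClosed (P.range : Set H) := by
    have : (P.range : Set H) = {x | P x = x} := by
      ext x
      exact ⟨by rintro ⟨y, rfl⟩; exact hPP y, fun hx => ⟨x, hx⟩⟩
    rw [this]
    exact isClosed_eq P.continuous continuous_id
  have : CompleteSpace P.range := hclosed.completeSpace_coe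
  have hV : ∀ v ∈ P.range, P.toLinearMap v ∈ P.range := fun v _ => ⟨v, rfl⟩
  have hr : IsCompactOperator (P.toLinearMap.restrict hV) :=
    IsCompactOperator.restrict' (f := P.toLinearMap) hc hV
  refine isCompactOperator_id_iff_finiteDimensional (𝕜 := ℂ) |>.1 ?_
  have hid : (id : P.range → P.range) = P.toLinearMap.restrict hV := by
    funext ⟨x, y, hy⟩
    refine Subtype.ext ?_
    subst hy
    exact (hPP y).symm
  rw [hid]
  exact hr

/-- The Riesz projection of a Fredholm operator is of finite rank if `0` is the only possible
spectral point in the disc: modulo the compact operators the resolvent agrees with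
`(1 - ζ v)⁻¹ v`, with `v` a quasi-inverse, which has no singularity at `ζ = 0`. -/
theorem isFiniteRank_rieszProj {T : H →L[ℂ] H} (hT : T.IsFredholm) {ε : ℝ} (hε : 0 < ε)
    (h : ∀ ζ : ℂ, 0 < ‖ζ‖ → ‖ζ‖ ≤ ε → IsUnit (T - ζ • (1 : H →L[ℂ] H))) :
    IsFiniteRank (rieszProj T ε) := by
  have hsph : ∀ r, 0 < r → r ≤ ε → ∀ ζ ∈ Metric.sphere (0 : ℂ) r,
      IsUnit (T - ζ • (1 : H →L[ℂ] H)) := by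
    intro r hr hrε ζ hζ
    rw [mem_sphere_zero_iff_norm] at hζ
    exact h ζ (hζ ▸ hr) (hζ ▸ hrε)
  refine isFiniteRank_of_isCompactOperator
    (isIdempotentElem_rieszIdem hε (hsph ε hε le_rfl)) ?_
  obtain ⟨v, hv⟩ := hT.exists_isQuasiInverse
  have hK : IsFiniteRank (v * T - 1) :=
    isFiniteRank_iff_hasFiniteRange.2 (LinearMap.FiniteRangeSetoid.equiv_iff_hasFiniteRange.1 hv.1)
  -- a radius so small that `1 - ζ v` is invertible in the closed disc
  let r := min ε (1 / (‖v‖ + 1))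
  have hv1 : 0 < ‖v‖ + 1 := by positivity
  have hr : 0 < r := lt_min hε (by positivity)
  have hrv : ∀ ζ ∈ Metric.closedBall (0 : ℂ) r, IsUnit (1 - ζ • v) := by
    intro ζ hζ
    rw [mem_closedBall_zero_iff] at hζ
    refine isUnit_one_sub_of_norm_lt_one ?_
    have h1 : ‖ζ‖ ≤ 1 / (‖v‖ + 1) := hζ.trans (min_le_right _ _)
    calc ‖ζ • v‖ = ‖ζ‖ * ‖v‖ := norm_smul _ _
      _ ≤ 1 / (‖v‖ + 1) * ‖v‖ := by gcongr
      _ < 1 := by rw [one_div_mul_eq_div, div_lt_one hv1]; linarith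
  let S : ℂ → H →L[ℂ] H := fun ζ => Ring.inverse (1 - ζ • v) * v
  have hSd : ∀ ζ ∈ Metric.closedBall (0 : ℂ) r, DifferentiableAt ℂ S ζ := by
    intro ζ hζ
    refine DifferentiableAt.mul ?_ (by fun_prop)
    exact DifferentiableAt.inverse (by fun_prop) (hrv ζ hζ)
  have hSint : (∮ ζ in C(0, r), S ζ) = 0 :=
    Complex.circleIntegral_eq_zero_of_differentiable_on_off_countable hr.le Set.countable_empty
      (fun ζ hζ => (hSd ζ hζ).continuousAt.continuousWithinAt)
      fun ζ hζ => hSd ζ (Metric.ball_subset_closedBall hζ.1)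
  let ρ : ℂ → H →L[ℂ] H := fun ζ => Ring.inverse (T - ζ • (1 : H →L[ℂ] H))
  have hdiff : ∀ ζ ∈ Metric.sphere (0 : ℂ) r, IsCompactOperator (S ζ - ρ ζ) := by
    intro ζ hζ
    have hu := hsph r hr (min_le_left _ _) ζ hζ
    have hw := hrv ζ (Metric.sphere_subset_closedBall hζ)
    have e : S ζ - ρ ζ = Ring.inverse (1 - ζ • v) * ((v * T - 1) * ρ ζ) := by
      have e1 : v * (T - ζ • (1 : H →L[ℂ] H)) = (v * T - 1) + (1 - ζ • v) := by
        rw [mul_sub, mul_smul_comm, mul_one]; abel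
      have e2 : v = (v * T - 1) * ρ ζ + (1 - ζ • v) * ρ ζ := by
        rw [← add_mul, ← e1, mul_assoc, Ring.mul_inverse_cancel _ hu, mul_one]
      have e3 : S ζ = Ring.inverse (1 - ζ • v) * ((v * T - 1) * ρ ζ + (1 - ζ • v) * ρ ζ) := by
        rw [← e2]
      rw [e3, mul_add, ← mul_assoc (Ring.inverse _) (1 - ζ • v), Ring.inverse_mul_cancel _ hw,
        one_mul, add_sub_cancel_right]
    rw [e]
    exact ((hK.isCompactOperator.comp_clm (ρ ζ)).clm_comp (Ring.inverse (1 - ζ • v)))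
  let K : Submodule ℂ (H →L[ℂ] H) := compactOperator (RingHom.id ℂ) H H
  have hKc : IsClosed (K : Set (H →L[ℂ] H)) := isClosed_setOfPred_isCompactOperator
  have : IsClosed (K.toAddSubgroup : Set (H →L[ℂ] H)) := hKc
  have hρi : CircleIntegrable ρ 0 r := circleIntegrable_resolvent hr (hsph r hr (min_le_left _ _))
  have hSi : CircleIntegrable S 0 r :=
    ContinuousOn.circleIntegrable hr.le fun ζ hζ =>
      (hSd ζ (Metric.sphere_subset_closedBall hζ)).continuousAt.continuousWithinAt
  have hmem : (∮ ζ in C(0, r), ρ ζ) ∈ K := by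
    rw [← Submodule.Quotient.mk_eq_zero]
    have e1 := circleIntegral_clm_comp K.mkQL hρi
    have e2 := circleIntegral_clm_comp K.mkQL hSi
    rw [hSint, map_zero] at e2
    rw [circleIntegral.integral_congr hr.le (g := fun ζ => K.mkQL (S ζ)), e2] at e1
    · exact e1.symm
    · intro ζ hζ
      refine ((Submodule.Quotient.eq K).2 ?_).symm
      exact hdiff ζ hζ
  have hrr : rieszProj T ε = rieszIdem T r :=
    rieszIdem_eq_of_le hr (min_le_left _ _) fun ζ h1 h2 => h ζ (hr.trans_le h1) h2
  rw [hrr]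
  exact K.smul_mem _ hmem

/-- Near `z₀`, `A` is analytically equivalent to the extension by the identity of the block that
defines Howland's quantity. -/
theorem exists_isFiniteBlock {A : ℂ → H →L[ℂ] H} {z₀ : ℂ} (hA : AnalyticAt ℂ A z₀) {ε : ℝ}
    (hε : 0 < ε) (h : ∀ ζ ∈ Metric.sphere (0 : ℂ) ε, IsUnit (A z₀ - ζ • (1 : H →L[ℂ] H))) :
    ∃ (π : H →L[ℂ] (rieszProj (A z₀) ε).range)
      (F : ℂ → (rieszProj (A z₀) ε).range →L[ℂ] (rieszProj (A z₀) ε).range),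
      IsFiniteBlock A z₀ (rieszProj (A z₀) ε).range π F ∧
      ∀ z, (F z).toLinearMap = rieszBlock A z₀ ε z := by
  obtain ⟨hPa, hev⟩ := analyticAt_rieszIdem hA hε h
  set P : ℂ → H →L[ℂ] H := fun z => rieszIdem (A z) ε with hP
  set P₀ := rieszProj (A z₀) ε with hP₀
  have hP₀' : P z₀ = P₀ := rfl
  have hidem : P₀ * P₀ = P₀ := isIdempotentElem_rieszIdem hε h
  have hidem₀ : IsIdempotentElem P₀ := hidem
  let π : H →L[ℂ] P₀.range := P₀.codRestrict P₀.range fun x => ⟨x, rfl⟩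
  have hπ : ∀ w : P₀.range, π w = w := by
    rintro ⟨_, y, rfl⟩
    exact Subtype.ext congr($hidem y)
  let T := wolfTransform A z₀ ε
  have hT : AnalyticAt ℂ T z₀ := by
    have : T = fun z => P₀ * P z + (1 - P₀) * (1 - P z) := rfl
    rw [this]
    fun_prop
  have hT0 : T z₀ = 1 := by
    change P₀ * P₀ + (1 - P₀) * (1 - P₀) = 1
    rw [hidem, hidem₀.one_sub.eq]
    abel
  have hTu : IsUnit (T z₀) := hT0 ▸ isUnit_one
  have hTi := analyticAt_ringInverse hT hTu
  let X : ℂ → H →L[ℂ] H := fun z => T z * A z * Ring.inverse (T z)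
  have hX : AnalyticAt ℂ X z₀ := (hT.mul hA).mul hTi
  have hX0 : X z₀ = A z₀ := by simp [X, hT0]
  let F : ℂ → P₀.range →L[ℂ] P₀.range := fun z => π ∘L X z ∘L P₀.range.subtypeL
  have hF : AnalyticAt ℂ F z₀ := by
    let L : (H →L[ℂ] H) →L[ℂ] (P₀.range →L[ℂ] P₀.range) :=
      (ContinuousLinearMap.compL ℂ P₀.range H P₀.range π) ∘L
        ((ContinuousLinearMap.compL ℂ P₀.range H H).flip P₀.range.subtypeL)
    have hL := ContinuousLinearMap.analyticAt (𝕜 := ℂ) (E := H →L[ℂ] H)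
      (F := P₀.range →L[ℂ] P₀.range) L (X z₀)
    exact AnalyticAt.comp hL hX
  -- `1` on `ran P₀` plus the complementary block of `X(z)`; dividing by it leaves `F(z) ⊕ 1`
  let Y : ℂ → H →L[ℂ] H := fun z => P₀ + (1 - P₀) * X z
  have hY : AnalyticAt ℂ Y z₀ := by fun_prop
  have hYu : IsUnit (Y z₀) := by
    change IsUnit (P₀ + (1 - P₀) * X z₀)
    rw [hX0]
    exact isUnit_rieszIdem_add hε h
  have hYi := analyticAt_ringInverse hY hYu
  have hinv : ∀ {U : H →L[ℂ] H}, IsUnit U → IsUnit (Ring.inverse U) := fun hU =>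
    isUnit_ringInverse.2 hU
  refine ⟨π, F, ⟨hπ, hF, T, fun z => Ring.inverse (T z) * Ring.inverse (Y z), hT, hTi.mul hYi, hTu,
    (hinv hTu).mul (hinv hYu), ?_⟩, fun z => rfl⟩
  filter_upwards [hev, eventually_isUnit hT.continuousAt hTu,
    eventually_isUnit hY.continuousAt hYu] with z hz hTz hYz
  have hPz : IsIdempotentElem (P z) := isIdempotentElem_rieszIdem hε hz
  have hPA : A z * P z = P z * A z := commute_rieszIdem hε hz
  -- `T(z)` intertwines the projections `P(z)` and `P(z₀)`
  have e1 : T z * P z = P₀ * P z := by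
    change (P₀ * P z + (1 - P₀) * (1 - P z)) * P z = _
    rw [add_mul, mul_assoc, hPz.eq, mul_assoc, hPz.one_sub_mul_self, mul_zero, add_zero]
  have e2 : P₀ * T z = P₀ * P z := by
    change P₀ * (P₀ * P z + (1 - P₀) * (1 - P z)) = _
    rw [mul_add, ← mul_assoc, hidem, ← mul_assoc, hidem₀.mul_one_sub_self, zero_mul, add_zero]
  have e3 : P z * Ring.inverse (T z) = Ring.inverse (T z) * P₀ := by
    refine hTz.mul_left_cancel (hTz.mul_right_cancel ?_)
    rw [← mul_assoc, mul_assoc (T z * P z), Ring.inverse_mul_cancel _ hTz, mul_one, ← mul_assoc,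
      Ring.mul_inverse_cancel _ hTz, one_mul, e1, e2]
  have hcomm : P₀ * X z = X z * P₀ := by
    change P₀ * (T z * A z * Ring.inverse (T z)) = T z * A z * Ring.inverse (T z) * P₀
    rw [mul_assoc (T z * A z), ← e3, ← mul_assoc, ← mul_assoc, e2, ← e1,
      mul_assoc (T z) (P z), ← hPA]
    simp only [mul_assoc]
  have hD : extendByOne π (F z) = P₀ * X z * P₀ + (1 - P₀) := by
    ext x
    rfl
  change T z * A z * (Ring.inverse (T z) * Ring.inverse (Y z)) = extendByOne π (F z)
  have hXD : X z = (P₀ * X z * P₀ + (1 - P₀)) * Y z := by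
    change X z = (P₀ * X z * P₀ + (1 - P₀)) * (P₀ + (1 - P₀) * X z)
    have f1 : P₀ * X z * P₀ * P₀ = P₀ * X z := by
      rw [mul_assoc, hidem, mul_assoc, ← hcomm, ← mul_assoc, hidem]
    have f2 : P₀ * X z * P₀ * ((1 - P₀) * X z) = 0 := by
      rw [mul_assoc (P₀ * X z), ← mul_assoc P₀ (1 - P₀), hidem₀.mul_one_sub_self, zero_mul,
        mul_zero]
    have f3 : (1 - P₀) * ((1 - P₀) * X z) = (1 - P₀) * X z := by
      rw [← mul_assoc, hidem₀.one_sub.eq]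
    rw [add_mul, mul_add, mul_add, f1, f2, f3, hidem₀.one_sub_mul_self, sub_mul, one_mul]
    abel
  rw [← mul_assoc, hD]
  change X z * _ = _
  conv_lhs => rw [hXD]
  rw [mul_assoc, Ring.mul_inverse_cancel _ hYz, mul_one]

end Howland

end

theorem theorem3p5 {H : Type*} [NormedAddCommGroup H] [InnerProductSpace ℂ H] [CompleteSpace H]
    {Ω : Set ℂ} (hΩ : IsOpen Ω) (hΩc : IsConnected Ω)
    {A : ℂ → H →L[ℂ] H} (hA : AnalyticOnNhd ℂ A Ω) (hF : ∀ z ∈ Ω, (A z).IsFredholm)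
    {z₀ : ℂ} (hz₀ : z₀ ∈ Ω) {n₀ : ℕ} (hn₀ : 1 ≤ n₀) (hpole : Howland.InverseHasPole A z₀ n₀) :
    ∃ (P : Fin n₀ → H →L[ℂ] H) (B : ℂ → H →L[ℂ] H),
      -- the `P j` are projections of finite, positive, non-increasing rank
      (∀ j, IsIdempotentElem (P j)) ∧
      (∀ j, FiniteDimensional ℂ (P j).range) ∧
      (∀ j, 1 ≤ Module.finrank ℂ (P j).range) ∧
      (Antitone fun j => Module.finrank ℂ (P j).range) ∧
      -- the factorization, with `Q j = 1 - P j`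
      (∀ z ∈ Ω, A z = (List.ofFn fun j => (1 - P j) - (z - z₀) • P j).prod * B z) ∧
      AnalyticOnNhd ℂ B Ω ∧
      (∀ z ∈ Ω, (B z).IsFredholm) ∧
      (∀ᶠ z in 𝓝 z₀, Howland.index (A z) = 0 ∧ Howland.index (B z) = 0) ∧
      (∀ᶠ z in 𝓝 z₀, IsUnit (B z)) ∧
      -- the first rank is the geometric multiplicity
      Module.finrank ℂ (P ⟨0, hn₀⟩).range = Module.finrank ℂ (A z₀).ker ∧
      -- the sum of the ranks and Howland's quantity
      Module.finrank ℂ (A z₀).ker ≤ ∑ j, Module.finrank ℂ (P j).range ∧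
      n₀ ≤ ∑ j, Module.finrank ℂ (P j).range ∧
      (∀ ε : ℝ, 0 < ε → (∀ ζ : ℂ, 0 < ‖ζ‖ → ‖ζ‖ ≤ ε → ζ ∈ resolventSet ℂ (A z₀)) →
        Howland.nu A z₀ ε = ((∑ j, Module.finrank ℂ (P j).range : ℕ) : WithTop ℤ) ∧
        (Module.finrank ℂ (A z₀).ker : WithTop ℤ) ≤ Howland.nu A z₀ ε ∧
        (n₀ : WithTop ℤ) ≤ Howland.nu A z₀ ε) ∧
      -- operator ideals
      (∀ z ∈ Ω, Howland.IsFiniteRank (1 - A z) ↔ Howland.IsFiniteRank (1 - B z)) ∧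
      (∀ p : ℝ≥0∞, 1 ≤ p → ∀ z ∈ Ω,
        Howland.IsSchatten p (1 - A z) ↔ Howland.IsSchatten p (1 - B z)) := by
  obtain ⟨P, B, h1, h2, h3, h4, h5, h6, h7, h8, -, h10, h11, h12⟩ :=
    Howland.exists_factorization hΩ hz₀ n₀ hA hF hpole
  have hAc : ContinuousAt A z₀ := (hA z₀ hz₀).continuousAt
  have hBu : ∀ᶠ z in 𝓝 z₀, IsUnit (B z) :=
    Howland.eventually_isUnit (h6 z₀ hz₀).continuousAt h8
  have hA0 : Howland.index (A z₀) = 0 :=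
    Howland.index_eq_zero_of_mem_closure_isUnit (hF z₀ hz₀)
      (mem_closure_of_tendsto (hAc.mono_left nhdsWithin_le_nhds) hpole.1)
  have hAi : ∀ᶠ z in 𝓝 z₀, Howland.index (A z) = 0 := by
    filter_upwards [eventually_nhdsWithin_iff.1 hpole.1] with z hz
    by_cases hzz : z = z₀
    · rw [hzz, hA0]
    · exact Howland.index_of_isUnit (hz hzz)
  have hsum1 : Module.finrank ℂ (A z₀).ker ≤ ∑ j, Module.finrank ℂ (P j).range := by
    rw [← h10 hn₀]
    exact Finset.single_le_sum (f := fun j => Module.finrank ℂ (P j).range)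
      (fun _ _ => Nat.zero_le _) (Finset.mem_univ _)
  have hsum2 : n₀ ≤ ∑ j, Module.finrank ℂ (P j).range := by
    calc n₀ = ∑ _j : Fin n₀, 1 := by simp
      _ ≤ _ := Finset.sum_le_sum fun j _ => h3 j
  refine ⟨P, B, h1, h2, h3, h4, fun z _ => h5 z, h6, h7,
    hAi.and (hBu.mono fun z hz => Howland.index_of_isUnit hz), hBu, h10 hn₀, hsum1, hsum2,
    fun ε hε hres => ?_, fun z _ => Howland.isFiniteRank_iff_of_isFiniteRank_sub (h11 z),
    fun p _ z _ => Howland.isSchatten_iff_of_isFiniteRank_sub (h11 z)⟩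
  have hunit : ∀ ζ : ℂ, 0 < ‖ζ‖ → ‖ζ‖ ≤ ε → IsUnit (A z₀ - ζ • (1 : H →L[ℂ] H)) := by
    intro ζ hζ0 hζε
    have := (spectrum.mem_resolventSet_iff.1 (hres ζ hζ0 hζε)).neg
    rwa [neg_sub, Algebra.algebraMap_eq_smul_one] at this
  have : FiniteDimensional ℂ (Howland.rieszProj (A z₀) ε).range :=
    Howland.isFiniteRank_rieszProj (hF z₀ hz₀) hε hunit
  obtain ⟨π, F, hblock, hdet⟩ := Howland.exists_isFiniteBlock (hA z₀ hz₀) hε fun ζ hζ => by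
    rw [mem_sphere_zero_iff_norm] at hζ
    exact hunit ζ (hζ ▸ hε) hζ.le
  have hnu : Howland.nu A z₀ ε = ((∑ j, Module.finrank ℂ (P j).range : ℕ) : WithTop ℤ) := by
    rw [← h12 _ π F hblock]
    simp only [Howland.nu, hdet]
  refine ⟨hnu, ?_, ?_⟩
  · rw [hnu]
    exact_mod_cast hsum1
  · rw [hnu]
    exact_mod_cast hsum2
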